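/- For every $n\ge 1$ let $k=k_n\ge 2$, $d=d_n\ge 1$, and for each $\ell\in[d]$ let $p_{\ell,\theta}(y)=h_\ell(y)\,e^{u_\ell(y)\theta-\psi_\ell(\theta)}$, $\theta\in\Theta_\ell$, be a regular exponential family of densities with respect to a $\sigma$-finite measure $\nu_\ell$ on $\mathbb R$, with $h_\ell\ge 0$, $u_\ell:\mathbb R\to\mathbb R$, cumulant function $\psi_\ell(\theta)=\log\int h_\ell e^{u_\ell\theta}\,d\nu_\ell$ and open natural parameter space $\Theta_\ell=\{\theta:\psi_\ell(\theta)<\infty\}$. For $\theta_{a\ell}\in\Theta_\ell$ ($a\in[k]$) let $f_a(x)=\prod_{\ell=1}^d p_{\ell,\theta_{a\ell}}(x_\ell)$, let $\mu_{a\ell}=\mathbb E_{X\sim f_a}[u_\ell(X_\ell)]$, $\Delta=\max_{a\ne b}\|\mu_a-\mu_b\|_\infty$, let $\psi_\ell^*(y)=\sup_{\theta\in\Theta_\ell}(\theta y-\psi_\ell(\theta))$, and let $$\mathrm{Chernoff}(\mathcal F)=\min_{a\ne b}\Bigl(-\log\inf_{t\in(0,1)}\int f_a^{t}f_b^{1-t}\,d(\nu_1\otimes\cdots\otimes\nu_d)\Bigr).$$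 All these objects may depend on $n$. Let $z^*\in[k]^n$, and let $X_1,\dots,X_n$ be independent with $X_i\sim f_{z_i^*}$. All asymptotic statements are for $n\to\infty$, with constants independent of $n$ and uniform in $a\in[k]$, $\ell\in[d]$, $i\in[n]$. Suppose that 1. $u_\ell(X_{i\ell})$ is sub-exponential: there is $C>0$ with $\mathbb P(|u_\ell(X_{i\ell})-\mu_{z_i^*\ell}|\ge x)\le 2e^{-Cx}$ for all $x\ge 0$; 2. $k\log^2(dk)=o(n)$, and $|\{i:z_i^*=a\}|\ge \alpha n/k$ for all $a\in[k]$, for a constant $\alpha>0$; 3. $(\psi_\ell^*)''(\mu_{a\ell})=\Theta(1)$, and there is a constant $m>0$ such that each $\psi_\ell$ is $m$-strongly convex on the interval spanned by $\theta_{1\ell},\dots,\theta_{k\ell}$; 4. $\Delta=O(d^{-1}\mathrm{Chernoff}(\mathcal F))$ and $\mathrm{Chernoff}(\mathcal F)=\omega\bigl(d\sqrt k\,(1+\Delta/\sqrt{n/k})\bigr)$. For $z,z'\in[k]^n$ let $\mathrm{loss}(z,z')=\min_{\tau\in\mathrm{Sym}(k)}|\{i:z_i\ne\tau(z'_i)\}|$.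 Let $\hat z^{(0)}\in[k]^n$ be any (possibly data-dependent) initial labelling such that, for every $\varepsilon>0$, $\mathrm{loss}(z^*,\hat z^{(0)})\le \varepsilon\, n/(k\Delta)$ with probability $1-o(1)$. Let $\hat z^{(t)}$ be the labelling after $t$ iterations of Bregman hard clustering: each iteration computes, for all $a,\ell$, the average $\hat\mu_{a\ell}$ of $u_\ell(X_{i\ell})$ over the points $i$ with $\hat z^{(t-1)}_i=a$, and then takes $\hat z_i^{(t)}\in\arg\min_{a\in[k]}\sum_{\ell=1}^d \mathrm{Breg}_{\psi_\ell^*}(u_\ell(X_{i\ell})\,\|\,\hat\mu_{a\ell})$, where $\mathrm{Breg}_\varphi(x\|y)=\varphi(x)-\varphi(y)-(x-y)\varphi'(y)$ and ties are broken arbitrarily. Then for every constant $c>0$, with probability $1-o(1)$, $$n^{-1}\,\mathrm{loss}(z^*,\hat z^{(t)})\le e^{-(1+o(1))\,\mathrm{Chernoff}(\mathcal F)}\qquad\text{for all } t\ge\lfloor c\log n\rfloor .$$ -/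

import Mathlib

open MeasureTheory ProbabilityTheory Filter Topology Asymptotics

/-- A regular one-parameter exponential family on the real line: a reference measure, a carrier
function `h ≥ 0` and a sufficient statistic `u`, with densities proportional to
`h x * exp (u x * θ)` over the (open) set of all `θ` for which this function is integrable. -/
structure ExpFamily where
  /-- the reference measure -/
  ref : Measure ℝ
  sigmaFinite_ref : SigmaFinite ref
  /-- the carrier function -/
  h : ℝ → ℝ
  measurable_h : Measurable h
  h_nonneg : ∀ x, 0 ≤ h x
  /-- the sufficient statistic -/
  u : ℝ → ℝ
  measurable_u : Measurable u
  regular : IsOpen {θ : ℝ | Integrable (fun x => h x * Real.exp (u x * θ)) ref}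

attribute [instance] ExpFamily.sigmaFinite_ref

namespace ExpFamily

/-- The natural parameter space. -/
def natParam (E : ExpFamily) : Set ℝ :=
  {θ : ℝ | Integrable (fun x => E.h x * Real.exp (E.u x * θ)) E.ref}

/-- The cumulant function (log-normalizer) `ψ`. -/
noncomputable def cumulant (E : ExpFamily) (θ : ℝ) : ℝ :=
  Real.log (∫ x, E.h x * Real.exp (E.u x * θ) ∂E.ref)

/-- The density of the member with natural parameter `θ`. -/
noncomputable def pdf (E : ExpFamily) (θ x : ℝ) : ℝ :=
  E.h x * Real.exp (E.u x * θ - E.cumulant θ)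

/-- The mean parameter: the expectation of `u` under the member with natural parameter `θ`. -/
noncomputable def mean (E : ExpFamily) (θ : ℝ) : ℝ :=
  ∫ x, E.u x * E.pdf θ x ∂E.ref

/-- The Legendre transform `ψ*` of the cumulant function. -/
noncomputable def dual (E : ExpFamily) (y : ℝ) : ℝ :=
  sSup ((fun θ => θ * y - E.cumulant θ) '' E.natParam)

end ExpFamily

/-- The Bregman divergence `Breg_φ (x ‖ y)` of a generator `φ` on the real line. -/
noncomputable def bregman (φ : ℝ → ℝ) (x y : ℝ) : ℝ :=
  φ x - φ y - (x - y) * deriv φ y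

/-- The Chernoff information between two densities with respect to the measure `ν`. -/
noncomputable def chernoff {S : Type*} [MeasurableSpace S] (ν : Measure S) (f g : S → ℝ) : ℝ :=
  -Real.log (⨅ t : Set.Ioo (0 : ℝ) 1, ∫ x, f x ^ (t : ℝ) * g x ^ (1 - (t : ℝ)) ∂ν)

/-- The density on `ℝ^d` with independent coordinates, the coordinate `l` being the member of
the family `E l` with natural parameter `θ l`. -/
noncomputable def productPdf {d : ℕ} (E : Fin d → ExpFamily) (θ : Fin d → ℝ) (x : Fin d → ℝ) : ℝ :=
  ∏ l, (E l).pdf (θ l) (x l)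

/-- The product of the reference measures. -/
noncomputable def productRef {d : ℕ} (E : Fin d → ExpFamily) : Measure (Fin d → ℝ) :=
  Measure.pi (fun l => (E l).ref)

/-- The Chernoff information of the family of the `k` mixture components: the minimum over
pairs of different components. -/
noncomputable def chernoffFamily {d k : ℕ} (E : Fin d → ExpFamily) (θ : Fin k → Fin d → ℝ) : ℝ :=
  ⨅ p : {p : Fin k × Fin k // p.1 ≠ p.2},
    chernoff (productRef E) (productPdf E (θ p.1.1)) (productPdf E (θ p.1.2))

/-- The vector of means `μ_a` of a component with parameter vector `θ`. -/
noncomputable def meanVec {d : ℕ} (E : Fin d → ExpFamily) (θ : Fin d → ℝ) : Fin d → ℝ :=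
  fun l => (E l).mean (θ l)

/-- The largest distance `Δ` between cluster means, in the supremum norm
(the norm of `Fin d → ℝ`). -/
noncomputable def maxGap {d k : ℕ} (E : Fin d → ExpFamily) (θ : Fin k → Fin d → ℝ) : ℝ :=
  ⨆ p : {p : Fin k × Fin k // p.1 ≠ p.2}, ‖meanVec E (θ p.1.1) - meanVec E (θ p.1.2)‖

/-- The number of misclassified points, up to a global permutation of the labels. -/
noncomputable def labelLoss {n k : ℕ} (z z' : Fin n → Fin k) : ℕ :=
  ⨅ τ : Equiv.Perm (Fin k), hammingDist z (τ ∘ z')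

/-- The cluster with label `a` in the labelling `z`. -/
def cluster {n k : ℕ} (z : Fin n → Fin k) (a : Fin k) : Finset (Fin n) :=
  Finset.univ.filter (fun i => z i = a)

/-- The empirical mean of the sufficient statistic `u_l` over the cluster with label `a`
(with value `0` for an empty cluster). -/
noncomputable def empMean {n k d : ℕ} (E : Fin d → ExpFamily) (x : Fin n → Fin d → ℝ)
    (z : Fin n → Fin k) (a : Fin k) (l : Fin d) : ℝ :=
  (∑ i ∈ cluster z a, (E l).u (x i l)) / ((cluster z a).card : ℝ)

/-- The cost of giving the label `a` to the data point `y` when the cluster means are estimated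
from the labelling `z` of the data `x`. -/
noncomputable def bregmanCost {n k d : ℕ} (E : Fin d → ExpFamily) (x : Fin n → Fin d → ℝ)
    (z : Fin n → Fin k) (y : Fin d → ℝ) (a : Fin k) : ℝ :=
  ∑ l, bregman (E l).dual ((E l).u (y l)) (empMean E x z a l)

/-- `z'` results from `z` by one iteration of Bregman hard clustering: every data point receives
a label of minimal cost. Ties may be broken in any way. -/
def IsBregmanStep {n k d : ℕ} (E : Fin d → ExpFamily) (x : Fin n → Fin d → ℝ)
    (z z' : Fin n → Fin k) : Prop :=
  ∀ i a, bregmanCost E x z (x i) (z' i) ≤ bregmanCost E x z (x i) a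

/-! By Legendre duality, the Bregman cost of a label with its exact mean is the negative
log-likelihood of that component, up to a term common to all labels. Hence one iteration with nearly
exact means is nearly a likelihood ratio test, and such a test errs with probability about `exp
(-Chernoff)`.

The means are needed only to a small constant accuracy ρ. By `exists_bregman_dual_bound` the cost is
then off by O(ρ) times (ρ + |u - μ|) in each coordinate. Summed over coordinates, this is at most
δ/2 times the Chernoff information, because d and dΔ are O(Chernoff) and the sum of the deviations
|u - μ_z*| exceeds a multiple of Chernoff only with probability at most `exp (-2 Chernoff)`. So a
misclassified point lies in its `riskEvent`, which does not mention the current labelling. Markov's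
inequality (`measure_card_gt_le`) makes the set B of points at risk smaller than n `exp (-(1 - δ)
Chernoff)` with high probability.

Accuracy ρ holds simultaneously for all labellings with at most L₀ = εn/(kΔ) errors
(`abs_empMean_sub_le`), without a union bound over labellings. The sums over the true clusters
concentrate, and the mislabelled points contribute at most L₀(T + Δ) plus the total excess of the
deviations over a level T. The level T ~ k^(1/4) works on both sides. Strong convexity gives
Chernoff ≤ O(dΔ²), so separation by a large multiple of d√k forces T ≤ Δ and hence L₀T ≤ εn/k. The
total excess is at most εn/k because `exp (-cT)` is a small multiple of 1/k.

Since |B| ≤ L₀, the errors after any iteration lie in B, which keeps the next one in the good regime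
(`labelLoss_le_card_of_step`). The bound thus holds from the first iteration on. A diagonal choice
of δ tending to 0 gives the o(1) in the exponent. -/

/-! ### Exponential moments and cumulant generating functions. -/

lemma exp_le_one_add_add_sq_mul_exp_abs (x : ℝ) :
    Real.exp x ≤ 1 + x + x ^ 2 * Real.exp |x| := by
  have h := Complex.norm_exp_sub_sum_le_norm_mul_exp (x : ℂ) 2
  simp only [Finset.sum_range_succ, Finset.sum_range_zero] at h
  have h2 : ‖Complex.exp (x : ℂ) - (0 + (x : ℂ) ^ 0 / (Nat.factorial 0 : ℂ) +
      (x : ℂ) ^ 1 / (Nat.factorial 1 : ℂ))‖ = |Real.exp x - (1 + x)| := by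
    rw [← Real.norm_eq_abs, ← Complex.norm_real]
    push_cast
    simp
  rw [h2] at h
  simp only [Complex.norm_real, Real.norm_eq_abs, sq_abs] at h
  linarith [le_abs_self (Real.exp x - (1 + x))]

lemma abs_pow_le_factorial_div_mul_exp {c : ℝ} (hc : 0 < c) (x : ℝ) (n : ℕ) :
    |x| ^ n ≤ (n.factorial : ℝ) / c ^ n * Real.exp (c * |x|) := by
  have h := Real.pow_div_factorial_le_exp (c * |x|) (by positivity) n
  have hn : (0 : ℝ) < n.factorial := by exact_mod_cast n.factorial_pos
  rw [div_le_iff₀ hn, mul_pow] at h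
  rw [div_mul_eq_mul_div, le_div_iff₀ (by positivity)]
  linarith

/-- The random variable `w` has an exponential moment `E exp (c |w|) ≤ K`. -/
structure HasExpMoment {S : Type*} [MeasurableSpace S] (μ : Measure S) (w : S → ℝ)
    (c K : ℝ) : Prop where
  aemeasurable : AEMeasurable w μ
  integrable : Integrable (fun x => Real.exp (c * |w x|)) μ
  integral_le : ∫ x, Real.exp (c * |w x|) ∂μ ≤ K

/-- Layer-cake formula: levels t ≤ 1 contribute at most 1, and for t > 1 the tail of `exp (C / 2 *
|w|)` is at most 2t⁻², which integrates to 2. -/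
lemma hasExpMoment_of_tail {S : Type*} [MeasurableSpace S] {μ : Measure S}
    [IsProbabilityMeasure μ] {w : S → ℝ} {C : ℝ} (hC : 0 < C) (hw : AEMeasurable w μ)
    (htail : ∀ s : ℝ, 0 ≤ s → μ.real {x | s ≤ |w x|} ≤ 2 * Real.exp (-C * s)) :
    HasExpMoment μ w (C / 2) 3 := by
  have hm : AEMeasurable (fun x => Real.exp (C / 2 * |w x|)) μ := by fun_prop
  have key : ∫⁻ x, ENNReal.ofReal (Real.exp (C / 2 * |w x|)) ∂μ ≤ 3 := by
    rw [lintegral_eq_lintegral_meas_le μ (ae_of_all _ fun x => (Real.exp_pos _).le) hm]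
    have hsplit : Set.Ioi (0 : ℝ) = Set.Ioc 0 1 ∪ Set.Ioi 1 :=
      (Set.Ioc_union_Ioi_eq_Ioi zero_le_one).symm
    have h1 : ∫⁻ t in Set.Ioc (0 : ℝ) 1, μ {a | t ≤ Real.exp (C / 2 * |w a|)} ≤ 1 := by
      calc _ ≤ ∫⁻ t in Set.Ioc (0 : ℝ) 1, 1 := lintegral_mono fun t => prob_le_one
        _ = 1 := by simp
    have h2 : ∫⁻ t in Set.Ioi (1 : ℝ), μ {a | t ≤ Real.exp (C / 2 * |w a|)} ≤ 2 := by
      calc _ ≤ ∫⁻ t in Set.Ioi (1 : ℝ), ENNReal.ofReal (2 * t ^ (-2 : ℝ)) := by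
            refine setLIntegral_mono' measurableSet_Ioi fun t ht => ?_
            have ht0 : (0 : ℝ) < t := lt_trans one_pos ht
            have hset : {a | t ≤ Real.exp (C / 2 * |w a|)} = {a | Real.log t / (C / 2) ≤ |w a|} := by
              ext a
              simp only [Set.mem_ofPred_eq]
              rw [div_le_iff₀ (by positivity), Real.log_le_iff_le_exp ht0, mul_comm]
            rw [hset, ← ofReal_measureReal]
            refine ENNReal.ofReal_le_ofReal ((htail _ (div_nonneg (Real.log_nonneg (le_of_lt ht))
              (by positivity))).trans (le_of_eq ?_))
            rw [Real.rpow_def_of_pos ht0]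
            congr 2
            field_simp
        _ = ENNReal.ofReal (∫ t in Set.Ioi (1 : ℝ), 2 * t ^ (-2 : ℝ)) := by
            rw [ofReal_integral_eq_lintegral_ofReal]
            · exact (integrableOn_Ioi_rpow_of_lt (by norm_num) one_pos).const_mul 2
            · filter_upwards [ae_restrict_mem measurableSet_Ioi] with t ht
              have ht0 : (0 : ℝ) < t := lt_trans one_pos ht
              positivity
        _ = 2 := by
            rw [integral_const_mul, integral_Ioi_rpow_of_lt (by norm_num) one_pos]
            norm_num
    rw [hsplit]
    calc _ ≤ _ := lintegral_union_le _ _ _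
      _ ≤ 1 + 2 := add_le_add h1 h2
      _ = 3 := by norm_num
  have hint : Integrable (fun x => Real.exp (C / 2 * |w x|)) μ := by
    refine ⟨hm.aestronglyMeasurable, ?_⟩
    rw [hasFiniteIntegral_iff_ofReal (ae_of_all _ fun x => (Real.exp_pos _).le)]
    exact lt_of_le_of_lt key (by simp)
  refine ⟨hw, hint, ?_⟩
  rw [integral_eq_lintegral_of_nonneg_ae (ae_of_all _ fun x => (Real.exp_pos _).le)
    hint.aestronglyMeasurable]
  exact ENNReal.toReal_le_of_le_ofReal (by norm_num) (by simpa using key)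

namespace HasExpMoment

variable {S : Type*} [MeasurableSpace S] {μ : Measure S} {w : S → ℝ} {c K : ℝ}

lemma bound (h : HasExpMoment μ w c K) {g : S → ℝ} (hg : AEStronglyMeasurable g μ) {b : ℝ}
    (hb : 0 ≤ b) (hgb : ∀ x, |g x| ≤ b * Real.exp (c * |w x|)) :
    Integrable g μ ∧ |∫ x, g x ∂μ| ≤ b * K := by
  have hi := h.integrable.const_mul b
  refine ⟨hi.mono' hg (ae_of_all _ fun x => by simpa using hgb x), ?_⟩
  calc |∫ x, g x ∂μ| ≤ ∫ x, b * Real.exp (c * |w x|) ∂μ := by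
        rw [← Real.norm_eq_abs]
        exact norm_integral_le_of_norm_le hi (ae_of_all _ fun x => by simpa using hgb x)
    _ = b * ∫ x, Real.exp (c * |w x|) ∂μ := integral_const_mul _ _
    _ ≤ b * K := by gcongr; exact h.integral_le

lemma one_le [IsProbabilityMeasure μ] (h : HasExpMoment μ w c K) (hc : 0 ≤ c) : 1 ≤ K := by
  refine le_trans ?_ h.integral_le
  have : ∫ x, (1 : ℝ) ∂μ ≤ ∫ x, Real.exp (c * |w x|) ∂μ :=
    integral_mono (integrable_const _) h.integrable fun x => Real.one_le_exp (by positivity)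
  simpa using this

lemma integrable_pow_mul_exp (h : HasExpMoment μ w c K) (hc : 0 < c) {s : ℝ} (hs : |s| ≤ c / 2)
    (n : ℕ) : Integrable (fun x => w x ^ n * Real.exp (s * w x)) μ ∧
      |∫ x, w x ^ n * Real.exp (s * w x) ∂μ| ≤ (n.factorial : ℝ) / (c / 2) ^ n * K := by
  have := h.aemeasurable
  refine h.bound (by fun_prop) (by positivity) fun x => ?_
  rw [abs_mul, abs_pow, Real.abs_exp]
  calc |w x| ^ n * Real.exp (s * w x)
      ≤ ((n.factorial : ℝ) / (c / 2) ^ n * Real.exp (c / 2 * |w x|)) *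
        Real.exp (c / 2 * |w x|) := by
        refine mul_le_mul (abs_pow_le_factorial_div_mul_exp (by positivity) _ _) ?_
          (Real.exp_pos _).le (by positivity)
        refine Real.exp_le_exp.2 ((le_abs_self _).trans ?_)
        rw [abs_mul]; gcongr
    _ = _ := by rw [mul_assoc, ← Real.exp_add]; congr 2; ring

lemma integrable_pow (h : HasExpMoment μ w c K) (hc : 0 < c) (n : ℕ) :
    Integrable (fun x => w x ^ n) μ ∧
      |∫ x, w x ^ n ∂μ| ≤ (n.factorial : ℝ) / (c / 2) ^ n * K := by
  simpa using h.integrable_pow_mul_exp hc (s := 0) (by simp; positivity) n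

lemma integrable_exp_mul (h : HasExpMoment μ w c K) {s : ℝ} (hs : |s| ≤ c) :
    Integrable (fun x => Real.exp (s * w x)) μ := by
  have := h.aemeasurable
  refine (h.bound (by fun_prop) zero_le_one fun x => ?_).1
  rw [one_mul, Real.abs_exp]
  refine Real.exp_le_exp.2 ((le_abs_self _).trans ?_)
  rw [abs_mul]; gcongr

lemma mem_interior_integrableExpSet (h : HasExpMoment μ w c K) {s : ℝ} (hs : |s| < c) :
    s ∈ interior (integrableExpSet w μ) := by
  rw [mem_interior]
  refine ⟨Set.Ioo (-c) c, fun t ht => ?_, isOpen_Ioo, abs_lt.1 hs⟩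
  exact h.integrable_exp_mul (abs_le.2 ⟨ht.1.le, ht.2.le⟩)

/-- Second-order expansion of the exponential: the linear term vanishes by centring, and in the
remainder one half of the exponential moment pays for w², the other half for `exp |s * w|`. -/
lemma mgf_le_exp_sq [IsProbabilityMeasure μ] (h : HasExpMoment μ w c K) (hc : 0 < c)
    (hmean : ∫ x, w x ∂μ = 0) {s : ℝ} (hs : |s| ≤ c / 2) :
    mgf w μ s ≤ Real.exp (8 / c ^ 2 * K * s ^ 2) := by
  have hw := h.aemeasurable
  have hi1 : Integrable w μ := by simpa using (h.integrable_pow hc 1).1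
  have hb := h.bound (g := fun x => (s * w x) ^ 2 * Real.exp |s * w x|)
    (b := 2 / (c / 2) ^ 2 * s ^ 2) (by fun_prop) (by positivity) fun x => by
      rw [abs_mul, Real.abs_exp, abs_of_nonneg (sq_nonneg (s * w x)), mul_pow]
      have h2 := abs_pow_le_factorial_div_mul_exp (c := c / 2) (by positivity) (w x) 2
      rw [sq_abs] at h2
      calc s ^ 2 * w x ^ 2 * Real.exp |s * w x|
          ≤ s ^ 2 * ((2 : ℕ).factorial / (c / 2) ^ 2 * Real.exp (c / 2 * |w x|)) *
            Real.exp (c / 2 * |w x|) := by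
            refine mul_le_mul (by gcongr) ?_ (Real.exp_pos _).le (by positivity)
            rw [Real.exp_le_exp, abs_mul]; gcongr
        _ = 2 / (c / 2) ^ 2 * s ^ 2 * (Real.exp (c / 2 * |w x|) * Real.exp (c / 2 * |w x|)) := by
            simp [Nat.factorial]; ring
        _ = _ := by rw [← Real.exp_add]; congr 2; ring
  have hle : mgf w μ s ≤ ∫ x, (1 + s * w x + (s * w x) ^ 2 * Real.exp |s * w x|) ∂μ := by
    refine integral_mono (h.integrable_exp_mul (by linarith)) ?_ fun x => ?_
    · exact ((integrable_const _).add (hi1.const_mul s)).add hb.1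
    · exact exp_le_one_add_add_sq_mul_exp_abs _
  have hi2 : Integrable (fun x => 1 + s * w x) μ := (integrable_const _).add (hi1.const_mul s)
  rw [integral_add hi2 hb.1, integral_add (integrable_const _) (hi1.const_mul s), integral_const_mul, hmean] at hle
  simp only [integral_const, probReal_univ, smul_eq_mul, mul_one, mul_zero, add_zero] at hle
  have h3 := le_trans (le_abs_self _) hb.2
  calc mgf w μ s ≤ 1 + 8 / c ^ 2 * K * s ^ 2 := by
        refine hle.trans ?_
        have : 2 / (c / 2) ^ 2 * s ^ 2 * K = 8 / c ^ 2 * K * s ^ 2 := by field_simp; ring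
        linarith
    _ ≤ _ := by linarith [Real.add_one_le_exp (8 / c ^ 2 * K * s ^ 2)]

lemma one_le_mgf [IsProbabilityMeasure μ] (h : HasExpMoment μ w c K) (hc : 0 < c)
    (hmean : ∫ x, w x ∂μ = 0) {s : ℝ} (hs : Integrable (fun x => Real.exp (s * w x)) μ) :
    1 ≤ mgf w μ s := by
  have hi1 : Integrable w μ := by simpa using (h.integrable_pow hc 1).1
  have : ∫ x, (1 + s * w x) ∂μ ≤ mgf w μ s :=
    integral_mono ((integrable_const _).add (hi1.const_mul s)) hs
      fun x => by simpa [add_comm] using Real.add_one_le_exp (s * w x)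
  rw [integral_add (integrable_const _) (hi1.const_mul s), integral_const_mul, hmean] at this
  simpa using this

/-- The cumulant generating function of a centred variable with an exponential moment has a
second derivative bounded below near the origin in terms of the variance. -/
lemma le_iteratedDeriv_two_cgf [IsProbabilityMeasure μ] (h : HasExpMoment μ w c K) (hc : 0 < c)
    (hmean : ∫ x, w x ∂μ = 0) {s : ℝ} (hs : |s| ≤ c / 2) :
    ((∫ x, w x ^ 2 ∂μ) - (48 / c ^ 3 * K + 32 / c ^ 3 * K ^ 2) * |s|) / K ≤
      iteratedDeriv 2 (cgf w μ) s := by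
  have hK : 1 ≤ K := h.one_le hc.le
  have hK0 : 0 < K := by linarith
  have hin : s ∈ interior (integrableExpSet w μ) := h.mem_interior_integrableExpSet (by linarith)
  have hM1 : 1 ≤ mgf w μ s := h.one_le_mgf hc hmean (h.integrable_exp_mul (by linarith))
  have hMK : mgf w μ s ≤ K := by
    simpa [mgf] using le_trans (le_abs_self _) (h.integrable_pow_mul_exp hc hs 0).2
  rw [iteratedDeriv_two_cgf_eq_integral hin]
  set g := deriv (cgf w μ) s with hg
  have hgle : |g| ≤ 2 / c * K := by
    rw [hg, deriv_cgf hin, abs_div, abs_of_pos (by linarith : 0 < mgf w μ s)]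
    refine (div_le_self (abs_nonneg _) hM1).trans ?_
    have := (h.integrable_pow_mul_exp hc hs 1).2
    simp only [pow_one, Nat.factorial_one, Nat.cast_one] at this
    refine this.trans (le_of_eq ?_)
    field_simp
  have i1 : Integrable w μ := by simpa using (h.integrable_pow hc 1).1
  obtain ⟨i2, b2⟩ := h.integrable_pow hc 2
  obtain ⟨i3, b3⟩ := h.integrable_pow hc 3
  have iE : Integrable (fun x => (w x - g) ^ 2 * Real.exp (s * w x)) μ := by
    have e0 := (h.integrable_pow_mul_exp hc hs 0).1
    have e1 := (h.integrable_pow_mul_exp hc hs 1).1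
    have e2 := (h.integrable_pow_mul_exp hc hs 2).1
    refine ((e2.sub (e1.const_mul (2 * g))).add (e0.const_mul (g ^ 2))).congr
      (ae_of_all _ fun x => ?_)
    simp only [Pi.add_apply, Pi.sub_apply]
    ring
  -- The second derivative is the variance under the tilted law, with tilted mean g. Bounding `exp
  -- (s * w)` below by 1 + sw reduces it to untilted moments.
  have hlow : (∫ x, w x ^ 2 ∂μ) + g ^ 2 + s * (∫ x, w x ^ 3 ∂μ) - 2 * s * g * ∫ x, w x ^ 2 ∂μ ≤
      ∫ x, (w x - g) ^ 2 * Real.exp (s * w x) ∂μ := by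
    have e : ∫ x, ((1 - 2 * s * g) * w x ^ 2 + s * w x ^ 3 + (s * g ^ 2 - 2 * g) * w x
        + g ^ 2) ∂μ ≤ ∫ x, (w x - g) ^ 2 * Real.exp (s * w x) ∂μ := by
      refine integral_mono ((((i2.const_mul _).add (i3.const_mul _)).add
        (i1.const_mul _)).add (integrable_const _)) iE fun x => ?_
      have := mul_le_mul_of_nonneg_left (Real.add_one_le_exp (s * w x)) (sq_nonneg (w x - g))
      refine le_trans (le_of_eq ?_) this
      ring
    have j2 : Integrable (fun x => (1 - 2 * s * g) * w x ^ 2 + s * w x ^ 3) μ :=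
      (i2.const_mul _).add (i3.const_mul _)
    have j3 : Integrable (fun x => (1 - 2 * s * g) * w x ^ 2 + s * w x ^ 3 +
        (s * g ^ 2 - 2 * g) * w x) μ := j2.add (i1.const_mul _)
    rw [integral_add j3 (integrable_const _), integral_add j2 (i1.const_mul _), integral_add (i2.const_mul _) (i3.const_mul _), integral_const_mul,
      integral_const_mul, integral_const_mul, hmean] at e
    simp only [integral_const, probReal_univ, smul_eq_mul, one_mul, mul_zero] at e
    linarith
  have b2' : |∫ x, w x ^ 2 ∂μ| ≤ 8 / c ^ 2 * K := by
    refine b2.trans (le_of_eq ?_)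
    rw [show ((2 : ℕ).factorial : ℝ) = 2 by norm_num [Nat.factorial]]
    field_simp; ring
  have b3' : |∫ x, w x ^ 3 ∂μ| ≤ 48 / c ^ 3 * K := by
    refine b3.trans (le_of_eq ?_)
    rw [show ((3 : ℕ).factorial : ℝ) = 6 by norm_num [Nat.factorial]]
    field_simp; ring
  have t1 : -(48 / c ^ 3 * K * |s|) ≤ s * ∫ x, w x ^ 3 ∂μ := by
    have := neg_abs_le (s * ∫ x, w x ^ 3 ∂μ)
    rw [abs_mul] at this
    have := mul_le_mul_of_nonneg_left b3' (abs_nonneg s)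
    linarith
  have t2 : 2 * s * g * (∫ x, w x ^ 2 ∂μ) ≤ 32 / c ^ 3 * K ^ 2 * |s| := by
    refine (le_abs_self _).trans ?_
    rw [abs_mul, abs_mul, abs_mul, abs_two]
    calc 2 * |s| * |g| * |∫ x, w x ^ 2 ∂μ| ≤ 2 * |s| * (2 / c * K) * (8 / c ^ 2 * K) := by gcongr
      _ = _ := by field_simp; ring
  have hnum : (∫ x, w x ^ 2 ∂μ) - (48 / c ^ 3 * K + 32 / c ^ 3 * K ^ 2) * |s| ≤
      ∫ x, (w x - g) ^ 2 * Real.exp (s * w x) ∂μ := by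
    nlinarith [sq_nonneg g]
  have hpos : 0 ≤ ∫ x, (w x - g) ^ 2 * Real.exp (s * w x) ∂μ :=
    integral_nonneg fun x => by positivity
  calc _ ≤ (∫ x, (w x - g) ^ 2 * Real.exp (s * w x) ∂μ) / K := by gcongr
    _ ≤ _ := by gcongr

end HasExpMoment

/-- The tangent inequality for cumulant generating functions. -/
lemma cgf_tangent_le {S : Type*} [MeasurableSpace S] {μ : Measure S} [IsProbabilityMeasure μ]
    {w : S → ℝ} {s t : ℝ} (hs : s ∈ interior (integrableExpSet w μ))
    (ht : t ∈ integrableExpSet w μ) :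
    cgf w μ s + deriv (cgf w μ) s * (t - s) ≤ cgf w μ t := by
  have hsi : Integrable (fun x => Real.exp (s * w x)) μ :=
    (interior_subset hs : s ∈ integrableExpSet w μ)
  have hti : Integrable (fun x => Real.exp (t * w x)) μ := ht
  have hM : 0 < mgf w μ s := mgf_pos hsi
  set g := deriv (cgf w μ) s with hg
  have hgM : ∫ x, w x * Real.exp (s * w x) ∂μ = g * mgf w μ s := by
    rw [hg, deriv_cgf hs, div_mul_cancel₀ _ hM.ne']
  have hwi : Integrable (fun x => w x * Real.exp (s * w x)) μ := by
    simpa using integrable_pow_mul_exp_of_mem_interior_integrableExpSet hs 1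
  -- Jensen's inequality for the law tilted by s, whose mean is g.
  have key : Real.exp ((t - s) * g) * mgf w μ s ≤ mgf w μ t := by
    have e : ∫ x, Real.exp ((t - s) * g) * ((1 - (t - s) * g) * Real.exp (s * w x) +
        (t - s) * (w x * Real.exp (s * w x))) ∂μ ≤ mgf w μ t := by
      refine integral_mono (((hsi.const_mul _).add (hwi.const_mul _)).const_mul _) hti
        fun x => ?_
      have h1 := Real.add_one_le_exp ((t - s) * (w x - g))
      calc Real.exp ((t - s) * g) * ((1 - (t - s) * g) * Real.exp (s * w x) +
            (t - s) * (w x * Real.exp (s * w x)))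
          = Real.exp ((t - s) * g) * Real.exp (s * w x) * ((t - s) * (w x - g) + 1) := by ring
        _ ≤ Real.exp ((t - s) * g) * Real.exp (s * w x) * Real.exp ((t - s) * (w x - g)) := by
            gcongr
        _ = Real.exp (t * w x) := by
            rw [← Real.exp_add, ← Real.exp_add]; congr 1; ring
    rw [integral_const_mul, integral_add (hsi.const_mul _) (hwi.const_mul _),
      integral_const_mul, integral_const_mul, hgM] at e
    change Real.exp ((t - s) * g) * ((1 - (t - s) * g) * mgf w μ s + _) ≤ _ at e
    refine le_trans (le_of_eq ?_) e
    ring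
  have := Real.log_le_log (by positivity) key
  rw [Real.log_mul (Real.exp_pos _).ne' hM.ne', Real.log_exp] at this
  simp only [cgf]
  linarith

/-! ### Legendre duality between natural and mean parameters. -/

namespace ExpFamily

/-- The member of the family with natural parameter `θ`, as a measure on the real line. -/
noncomputable def law (E : ExpFamily) (θ : ℝ) : Measure ℝ :=
  E.ref.withDensity (fun x => ENNReal.ofReal (E.pdf θ x))

/-- The sufficient statistic, centred at the mean of the member with parameter `θ`. -/
noncomputable def centred (E : ExpFamily) (θ x : ℝ) : ℝ := E.u x - E.mean θ

variable (E : ExpFamily) {θ : ℝ}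

@[fun_prop]
lemma measurable_pdf (θ : ℝ) : Measurable (E.pdf θ) := by
  have := E.measurable_h
  have := E.measurable_u
  unfold pdf
  fun_prop

@[fun_prop]
lemma measurable_centred (θ : ℝ) : Measurable (E.centred θ) := by
  have := E.measurable_u
  unfold centred
  fun_prop

lemma pdf_nonneg (θ x : ℝ) : 0 ≤ E.pdf θ x := mul_nonneg (E.h_nonneg x) (Real.exp_pos _).le

lemma integral_law (θ : ℝ) (g : ℝ → ℝ) : ∫ x, g x ∂(E.law θ) = ∫ x, g x * E.pdf θ x ∂E.ref := by
  unfold law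
  rw [integral_withDensity_eq_integral_toReal_smul (by fun_prop) (by simp)]
  simp only [ENNReal.toReal_ofReal (E.pdf_nonneg _ _), smul_eq_mul, mul_comm]

lemma integrable_law_iff (θ : ℝ) (g : ℝ → ℝ) :
    Integrable g (E.law θ) ↔ Integrable (fun x => g x * E.pdf θ x) E.ref := by
  unfold law
  rw [integrable_withDensity_iff (by fun_prop) (by simp)]
  simp only [ENNReal.toReal_ofReal (E.pdf_nonneg _ _)]

lemma pdf_eq (θ x : ℝ) :
    E.pdf θ x = Real.exp (-E.cumulant θ) * (E.h x * Real.exp (E.u x * θ)) := by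
  unfold pdf
  rw [sub_eq_add_neg, Real.exp_add]
  ring

lemma integrable_pdf (hθ : θ ∈ E.natParam) : Integrable (E.pdf θ) E.ref := by
  have h : Integrable (fun x => E.h x * Real.exp (E.u x * θ)) E.ref := hθ
  exact (h.const_mul (Real.exp (-E.cumulant θ))).congr (ae_of_all _ fun x => (E.pdf_eq θ x).symm)

lemma exp_centred_mul_pdf (θ s x : ℝ) : Real.exp (s * E.centred θ x) * E.pdf θ x =
    Real.exp (-(s * E.mean θ) - E.cumulant θ) * (E.h x * Real.exp (E.u x * (θ + s))) := by
  rw [pdf, centred, mul_left_comm, mul_left_comm _ (E.h x), ← Real.exp_add, ← Real.exp_add]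
  ring_nf

lemma mem_integrableExpSet_centred_iff (θ s : ℝ) :
    s ∈ integrableExpSet (E.centred θ) (E.law θ) ↔ θ + s ∈ E.natParam := by
  change Integrable _ _ ↔ Integrable _ _
  rw [integrable_law_iff]
  simp only [exp_centred_mul_pdf]
  exact integrable_const_mul_iff (Real.exp_pos _).ne'.isUnit _

lemma isOpen_integrableExpSet_centred (θ : ℝ) :
    IsOpen (integrableExpSet (E.centred θ) (E.law θ)) := by
  have : integrableExpSet (E.centred θ) (E.law θ) = (fun s => θ + s) ⁻¹' E.natParam := by
    ext s
    exact E.mem_integrableExpSet_centred_iff θ s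
  rw [this]
  exact E.regular.preimage (by fun_prop)

/-- Shifting the natural parameter is an exponential tilt, so ψ around θ is, up to an affine
function, the cumulant generating function of the centred statistic. All convexity of ψ needed below
is read off from it. -/
lemma cumulant_add [IsProbabilityMeasure (E.law θ)] {s : ℝ}
    (hs : s ∈ integrableExpSet (E.centred θ) (E.law θ)) :
    E.cumulant (θ + s) =
      E.cumulant θ + s * E.mean θ + cgf (E.centred θ) (E.law θ) s := by
  have hpos : 0 < mgf (E.centred θ) (E.law θ) s := mgf_pos hs
  have hm : mgf (E.centred θ) (E.law θ) s = Real.exp (-(s * E.mean θ) - E.cumulant θ) *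
      ∫ x, E.h x * Real.exp (E.u x * (θ + s)) ∂E.ref := by
    rw [mgf, integral_law]
    simp only [exp_centred_mul_pdf, integral_const_mul]
  have hZ : 0 < ∫ x, E.h x * Real.exp (E.u x * (θ + s)) ∂E.ref := by
    rw [hm] at hpos
    exact (pos_iff_pos_of_mul_pos hpos).1 (Real.exp_pos _)
  rw [cgf, hm, Real.log_mul (Real.exp_pos _).ne' hZ.ne', Real.log_exp]
  simp only [cumulant]
  ring

/-- At the mean of the member with parameter `θ + s` the supremum in the Legendre transform is
attained at `θ + s`. -/
lemma dual_eq [IsProbabilityMeasure (E.law θ)] {s y : ℝ}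
    (hs : s ∈ integrableExpSet (E.centred θ) (E.law θ))
    (hy : deriv (cgf (E.centred θ) (E.law θ)) s = y - E.mean θ) :
    E.dual y = (θ + s) * y - E.cumulant (θ + s) ∧
      ∀ t ∈ E.natParam, t * y - E.cumulant t ≤ E.dual y := by
  have hle : ∀ t ∈ E.natParam, t * y - E.cumulant t ≤ (θ + s) * y - E.cumulant (θ + s) := by
    intro t ht
    have ht' : t - θ ∈ integrableExpSet (E.centred θ) (E.law θ) := by
      rw [mem_integrableExpSet_centred_iff]; simpa using ht
    have h1 := E.cumulant_add hs
    have h2 := E.cumulant_add ht'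
    rw [add_sub_cancel] at h2
    have h3 := cgf_tangent_le (by rwa [(E.isOpen_integrableExpSet_centred θ).interior_eq]) ht'
      (s := s)
    rw [hy] at h3
    rw [h1, h2]
    nlinarith
  have : E.dual y = (θ + s) * y - E.cumulant (θ + s) := by
    refine IsGreatest.csSup_eq ⟨⟨θ + s, (E.mem_integrableExpSet_centred_iff θ s).1 hs, rfl⟩, ?_⟩
    rintro _ ⟨t, ht, rfl⟩
    exact hle t ht
  exact ⟨this, this ▸ hle⟩

lemma integrable_centred_mean [IsProbabilityMeasure (E.law θ)] {c K : ℝ} (hc : 0 < c)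
    (h : HasExpMoment (E.law θ) (E.centred θ) c K) : ∫ x, E.centred θ x ∂(E.law θ) = 0 := by
  have hi : Integrable (E.centred θ) (E.law θ) := by simpa using (h.integrable_pow hc 1).1
  have hu : Integrable E.u (E.law θ) :=
    (hi.add (integrable_const (E.mean θ))).congr (ae_of_all _ fun x => by simp [centred])
  have : ∫ x, E.u x ∂(E.law θ) = E.mean θ := by rw [integral_law, mean]
  simp only [centred]
  rw [integral_sub hu (integrable_const _), this]
  simp

lemma deriv_cgf_centred_zero [IsProbabilityMeasure (E.law θ)] {c K : ℝ} (hc : 0 < c)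
    (h : HasExpMoment (E.law θ) (E.centred θ) c K) :
    deriv (cgf (E.centred θ) (E.law θ)) 0 = 0 := by
  rw [deriv_cgf_zero (h.mem_interior_integrableExpSet (by simpa)), E.integrable_centred_mean hc h]
  simp

/-- Where the cumulant function is strongly convex, the Legendre transform near the mean is
attained and differentiable, with derivative the maximizing parameter. -/
lemma exists_dual_param [IsProbabilityMeasure (E.law θ)] {c K : ℝ} (hc : 0 < c)
    (h : HasExpMoment (E.law θ) (E.centred θ) c K) {r v : ℝ} (hr : 0 < r) (hrc : r < c)
    (hv : 0 < v)
    (hcv : ∀ s, |s| ≤ r → v ≤ iteratedDeriv 2 (cgf (E.centred θ) (E.law θ)) s) :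
    ∀ y, |y - E.mean θ| < v * r → ∃ s, |s| < r ∧ |s| ≤ |y - E.mean θ| / v ∧
      deriv (cgf (E.centred θ) (E.law θ)) s = y - E.mean θ ∧
      E.dual y = (θ + s) * y - E.cumulant (θ + s) ∧ HasDerivAt E.dual (θ + s) y := by
  set w := E.centred θ with hw
  set G := cgf w (E.law θ) with hG
  set F := deriv G with hF
  have hmem : ∀ s, |s| ≤ r → s ∈ interior (integrableExpSet w (E.law θ)) :=
    fun s hs => h.mem_interior_integrableExpSet (lt_of_le_of_lt hs hrc)
  have hdiff : ∀ s, |s| ≤ r → DifferentiableAt ℝ F s :=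
    fun s hs => (analyticAt_cgf (hmem s hs)).deriv.differentiableAt
  have hF' : ∀ s, deriv F s = iteratedDeriv 2 G s := fun s => by
    rw [iteratedDeriv_succ, iteratedDeriv_one]
  have hcont : ContinuousOn F (Set.Icc (-r) r) := fun s hs =>
    (hdiff s (abs_le.2 hs)).continuousAt.continuousWithinAt
  have hmono : ∀ s t, |s| ≤ r → |t| ≤ r → s ≤ t → v * (t - s) ≤ F t - F s := by
    intro s t hs ht hst
    refine Convex.mul_sub_le_image_sub_of_le_deriv (convex_Icc (-r) r) hcont ?_ ?_ s
      (abs_le.1 hs) t (abs_le.1 ht) hst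
    · intro x hx
      exact (hdiff x (abs_le.2 (interior_subset hx : x ∈ Set.Icc (-r) r))).differentiableWithinAt
    · intro x hx
      rw [hF']
      exact hcv x (abs_le.2 (interior_subset hx : x ∈ Set.Icc (-r) r))
  have habs : ∀ s t, |s| ≤ r → |t| ≤ r → v * |t - s| ≤ |F t - F s| := by
    intro s t hs ht
    rcases le_total s t with hst | hst
    · rw [abs_of_nonneg (sub_nonneg.2 hst)]
      exact (hmono s t hs ht hst).trans (le_abs_self _)
    · rw [abs_sub_comm t s, abs_sub_comm (F t), abs_of_nonneg (sub_nonneg.2 hst)]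
      exact (hmono t s ht hs hst).trans (le_abs_self _)
  have hF0 : F 0 = 0 := E.deriv_cgf_centred_zero hc h
  have hr0 : |(0 : ℝ)| ≤ r := by simpa using hr.le
  have hrr : |r| ≤ r := (abs_of_pos hr).le
  have hrn : |-r| ≤ r := by rw [abs_neg]; exact hrr
  -- F vanishes at 0 and has slope at least v on [-r, r], so by the intermediate value theorem it
  -- takes every value of modulus below vr.
  have key : ∀ y, |y - E.mean θ| < v * r → ∃ s, |s| < r ∧ |s| ≤ |y - E.mean θ| / v ∧
      F s = y - E.mean θ := by
    intro y hy
    rw [abs_lt] at hy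
    have h1 := hmono 0 r hr0 hrr hr.le
    have h2 := hmono (-r) 0 hrn hr0 (by linarith)
    rw [hF0] at h1 h2
    obtain ⟨s, hs, hsy⟩ := intermediate_value_Icc (by linarith : -r ≤ r) hcont
      (⟨by linarith, by linarith⟩ : y - E.mean θ ∈ Set.Icc (F (-r)) (F r))
    have h3 := habs 0 s hr0 (abs_le.2 hs)
    rw [hF0, sub_zero, sub_zero, hsy] at h3
    refine ⟨s, ?_, ?_, hsy⟩
    · have := abs_lt.2 hy
      by_contra hcon
      have := mul_le_mul_of_nonneg_left (not_lt.1 hcon) hv.le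
      linarith
    · rw [le_div_iff₀ hv]; linarith
  intro y hy
  obtain ⟨s, hs, hsle, hsy⟩ := key y hy
  have hsm := interior_subset (hmem s hs.le)
  obtain ⟨hd, hub⟩ := E.dual_eq hsm hsy
  refine ⟨s, hs, hsle, hsy, hd, ?_⟩
  rw [hasDerivAt_iff_isLittleO]
  have hev : ∀ᶠ y' in 𝓝 y, |y' - E.mean θ| < v * r :=
    ContinuousAt.eventually_lt (by fun_prop) continuousAt_const hy
  -- Testing each supremum with the other's maximizer traps the increment error between 0 and (s' -
  -- s)(y' - y), which is at most (y' - y)²/v.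
  have hO : (fun y' => E.dual y' - E.dual y - (y' - y) • (θ + s)) =O[𝓝 y]
      fun y' => (y' - y) ^ 2 := by
    refine IsBigO.of_bound (1 / v) ?_
    filter_upwards [hev] with y' hy'
    obtain ⟨s', hs', -, hsy'⟩ := key y' hy'
    have hsm' := interior_subset (hmem s' hs'.le)
    obtain ⟨hd', hub'⟩ := E.dual_eq hsm' hsy'
    have a1 := hub' (θ + s) ((E.mem_integrableExpSet_centred_iff θ s).1 hsm)
    have a2 := hub (θ + s') ((E.mem_integrableExpSet_centred_iff θ s').1 hsm')
    have hlip := habs s s' hs.le hs'.le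
    rw [hsy, hsy'] at hlip
    have e : y' - E.mean θ - (y - E.mean θ) = y' - y := by ring
    rw [e] at hlip
    rw [smul_eq_mul, Real.norm_eq_abs, Real.norm_eq_abs, abs_of_nonneg (sq_nonneg (y' - y)),
      abs_of_nonneg (by linarith)]
    have b1 : E.dual y' - E.dual y - (y' - y) * (θ + s) ≤ (s' - s) * (y' - y) := by
      linarith
    refine b1.trans ((le_abs_self _).trans ?_)
    rw [abs_mul, ← sq_abs (y' - y), div_mul_eq_mul_div, one_mul, le_div_iff₀ hv]
    nlinarith [abs_nonneg (y' - y)]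
  refine hO.trans_isLittleO ?_
  have : (fun y' : ℝ => (y' - y) ^ 2) =o[𝓝 y] fun y' => (y' - y) ^ 1 :=
    (isLittleO_pow_pow one_lt_two).comp_tendsto
      ((continuous_id.sub continuous_const).tendsto' y (0 : ℝ) (by simp))
  simpa using this

lemma deriv_cgf_centred_hasDerivAt_zero [IsProbabilityMeasure (E.law θ)] {c K : ℝ} (hc : 0 < c)
    (h : HasExpMoment (E.law θ) (E.centred θ) c K) :
    HasDerivAt (deriv (cgf (E.centred θ) (E.law θ))) (∫ x, E.centred θ x ^ 2 ∂(E.law θ)) 0 := by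
  have hin := h.mem_interior_integrableExpSet (s := 0) (by simpa)
  have h1 := (analyticAt_cgf hin).deriv.differentiableAt.hasDerivAt
  have h2 := iteratedDeriv_two_cgf hin
  rw [iteratedDeriv_succ, iteratedDeriv_one, E.deriv_cgf_centred_zero hc h] at h2
  simp only [zero_mul, Real.exp_zero, mul_one, mgf_zero, div_one, ne_eq, OfNat.ofNat_ne_zero,
    not_false_eq_true, zero_pow, sub_zero] at h2
  rwa [h2] at h1

end ExpFamily

/-! ### Curvature of the Legendre transform and stability of the Bregman cost. -/

lemma deriv_eq_zero_of_forall_ne {f : ℝ → ℝ} {a : ℝ} (h : ∀ y, y ≠ a → f y = 0) :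
    deriv f a = 0 := by
  by_cases hd : DifferentiableAt ℝ f a
  · have h1 : Tendsto f (𝓝[≠] a) (𝓝 (f a)) := hd.continuousAt.tendsto.mono_left nhdsWithin_le_nhds
    have h2 : Tendsto f (𝓝[≠] a) (𝓝 0) := by
      refine tendsto_const_nhds.congr' ?_
      filter_upwards [self_mem_nhdsWithin] with y hy using (h y hy).symm
    have h3 := tendsto_nhds_unique h1 h2
    have : f = fun _ => 0 := by
      ext y
      by_cases hy : y = a
      · rw [hy, h3]
      · exact h y hy
    rw [this]
    simp
  · exact deriv_zero_of_not_differentiableAt hd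

namespace ExpFamily

variable (E : ExpFamily) {θ : ℝ}

/-- A family with a degenerate sufficient statistic has a Legendre transform that is zero
(the supremum being infinite) away from the mean. -/
lemma iteratedDeriv_two_dual_of_degenerate [IsProbabilityMeasure (E.law θ)]
    (h : E.centred θ =ᵐ[E.law θ] 0) : iteratedDeriv 2 E.dual (E.mean θ) = 0 := by
  have hS : ∀ s, s ∈ integrableExpSet (E.centred θ) (E.law θ) := fun s => by
    refine (integrable_const (1 : ℝ)).congr ?_
    filter_upwards [h] with x hx
    simp [hx]
  have hcgf : ∀ s, cgf (E.centred θ) (E.law θ) s = 0 := fun s => by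
    rw [cgf, mgf_congr h]
    simp
  have hd : ∀ y, y ≠ E.mean θ → E.dual y = 0 := by
    intro y hy
    refine Real.sSup_of_not_bddAbove ?_
    rintro ⟨B, hB⟩
    have hB' : ∀ s : ℝ, (θ + s) * y - (E.cumulant θ + s * E.mean θ) ≤ B := fun s => by
      have := hB ⟨θ + s, (E.mem_integrableExpSet_centred_iff θ s).1 (hS s), rfl⟩
      simp only [E.cumulant_add (hS s), hcgf, add_zero] at this
      exact this
    have hne : y - E.mean θ ≠ 0 := sub_ne_zero.2 hy
    have := hB' ((B + 1 - θ * y + E.cumulant θ) / (y - E.mean θ))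
    have e : (B + 1 - θ * y + E.cumulant θ) / (y - E.mean θ) * (y - E.mean θ) =
      B + 1 - θ * y + E.cumulant θ := div_mul_cancel₀ _ hne
    linarith
  rw [iteratedDeriv_succ, iteratedDeriv_one]
  refine deriv_eq_zero_of_forall_ne fun y hy => ?_
  have : E.dual =ᶠ[𝓝 y] fun _ => 0 := by
    filter_upwards [isOpen_ne.mem_nhds hy] with z hz using hd z hz
  rw [this.deriv_eq]
  simp

/-- The point is the order of quantifiers: the radius depends only on c, K and v, hence serves all
families, coordinates and components at once. -/
lemma exists_iteratedDeriv_two_cgf_ge {c K v : ℝ} (hc : 0 < c) (hK : 1 ≤ K) (hv : 0 < v) :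
    ∃ r : ℝ, 0 < r ∧ r < c ∧ ∀ (E : ExpFamily) (θ : ℝ), IsProbabilityMeasure (E.law θ) →
      HasExpMoment (E.law θ) (E.centred θ) c K → v ≤ ∫ x, E.centred θ x ^ 2 ∂(E.law θ) →
      ∀ s, |s| ≤ r → v / (2 * K) ≤ iteratedDeriv 2 (cgf (E.centred θ) (E.law θ)) s := by
  have hK0 : 0 < K := by linarith
  set L := 48 / c ^ 3 * K + 32 / c ^ 3 * K ^ 2 with hL
  have hL0 : 0 < L := by positivity
  refine ⟨min (c / 2) (v / (2 * L)), by positivity,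
    lt_of_le_of_lt (min_le_left _ _) (by linarith), fun E θ hp h hvar s hs => ?_⟩
  have h1 := h.le_iteratedDeriv_two_cgf hc (E.integrable_centred_mean hc h)
    (hs.trans (min_le_left _ _))
  refine le_trans ?_ h1
  have h2 : L * |s| ≤ v / 2 := by
    have := hs.trans (min_le_right _ _)
    rw [le_div_iff₀ (by positivity)] at this
    linarith
  rw [← div_div]
  gcongr
  linarith

/-- For positive variance the second derivative of the dual at the mean is the reciprocal of the
variance. Zero variance is excluded by the lower bound m, since the default value 0 of an unbounded
`sSup` would make that derivative 0. -/
lemma inv_le_variance [IsProbabilityMeasure (E.law θ)] {c K m M : ℝ} (hc : 0 < c)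
    (h : HasExpMoment (E.law θ) (E.centred θ) c K) (hm : 0 < m)
    (hcurv : iteratedDeriv 2 E.dual (E.mean θ) ∈ Set.Icc m M) :
    M⁻¹ ≤ ∫ x, E.centred θ x ^ 2 ∂(E.law θ) := by
  have hK := h.one_le hc.le
  set v := ∫ x, E.centred θ x ^ 2 ∂(E.law θ) with hvdef
  have hv0 : 0 ≤ v := integral_nonneg fun x => sq_nonneg _
  rcases hv0.eq_or_lt with hv | hv
  · have h2 := (integral_eq_zero_iff_of_nonneg (fun x => sq_nonneg (E.centred θ x))
      (h.integrable_pow hc 2).1).1 hv.symm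
    have h3 : E.centred θ =ᵐ[E.law θ] 0 := by
      filter_upwards [h2] with x hx
      simpa using hx
    have h4 := hcurv.1
    rw [E.iteratedDeriv_two_dual_of_degenerate h3] at h4
    linarith
  · obtain ⟨r, hr, hrc, hcv⟩ := exists_iteratedDeriv_two_cgf_ge hc hK hv
    have hvK : 0 < v / (2 * K) := by positivity
    have hpar := E.exists_dual_param hc h hr hrc hvK (hcv E θ inferInstance h le_rfl)
    set F := deriv (cgf (E.centred θ) (E.law θ)) with hF
    set g : ℝ → ℝ := fun y => deriv E.dual y - θ with hg
    have hev : ∀ᶠ y in 𝓝 (E.mean θ), |y - E.mean θ| < v / (2 * K) * r :=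
      ContinuousAt.eventually_lt (by fun_prop) continuousAt_const (by simp; positivity)
    have hgy : ∀ y, |y - E.mean θ| < v / (2 * K) * r →
        |g y| ≤ |y - E.mean θ| / (v / (2 * K)) ∧ F (g y) = y - E.mean θ := by
      intro y hy
      obtain ⟨s, -, h1, h2, -, h3⟩ := hpar y hy
      have : g y = s := by rw [hg]; simp only [h3.deriv]; ring
      rw [this]
      exact ⟨h1, h2⟩
    have hg0 : g (E.mean θ) = 0 := by
      simpa using (hgy (E.mean θ) (by simp; positivity)).1
    have hgc : ContinuousAt g (E.mean θ) := by
      rw [ContinuousAt, hg0]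
      have h0 : Tendsto (fun y => |y - E.mean θ| / (v / (2 * K))) (𝓝 (E.mean θ)) (𝓝 0) :=
        Continuous.tendsto' (by fun_prop) _ _ (by simp)
      refine squeeze_zero_norm' ?_ h0
      filter_upwards [hev] with y hy using (hgy y hy).1
    have hFd : HasDerivAt (fun s => F s + E.mean θ) v (g (E.mean θ)) := by
      rw [hg0]
      exact (E.deriv_cgf_centred_hasDerivAt_zero hc h).add_const _
    -- Up to the shift by θ, the derivative of the dual inverts F near the mean, so its slope there
    -- is the reciprocal of F'(0).
    have hinv := HasDerivAt.of_local_left_inverse hgc hFd hv.ne' (by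
      filter_upwards [hev] with y hy
      rw [(hgy y hy).2]; ring)
    have hder : HasDerivAt (deriv E.dual) v⁻¹ (E.mean θ) := by
      simpa [hg] using hinv.add_const θ
    have h5 := hcurv.2
    rw [iteratedDeriv_succ, iteratedDeriv_one, hder.deriv] at h5
    exact inv_le_of_inv_le₀ hv h5

/-- The Bregman cost with an estimated mean `y` differs little from the negative log-likelihood
of the member with mean close to `y`. -/
theorem exists_bregman_dual_bound {c K m M : ℝ} (hc : 0 < c) (hK : 1 ≤ K) (hm : 0 < m) :
    ∃ r L : ℝ, 0 < r ∧ 0 < L ∧ ∀ (E : ExpFamily) (θ : ℝ), IsProbabilityMeasure (E.law θ) →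
      HasExpMoment (E.law θ) (E.centred θ) c K →
      iteratedDeriv 2 E.dual (E.mean θ) ∈ Set.Icc m M →
      ∀ y, |y - E.mean θ| ≤ r → ∀ x,
        |bregman E.dual x y - E.dual x - (E.cumulant θ - x * θ)| ≤
          L * |y - E.mean θ| * (|y - E.mean θ| + |x - E.mean θ|) := by
  by_cases hM : m ≤ M
  swap
  · exact ⟨1, 1, one_pos, one_pos, fun E θ _ _ h => absurd (h.1.trans h.2) hM⟩
  have hM0 : 0 < M := by linarith
  have hK0 : 0 < K := by linarith
  obtain ⟨r, hr, hrc, hcv⟩ := exists_iteratedDeriv_two_cgf_ge hc hK (inv_pos.2 hM0)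
  set v := M⁻¹ / (2 * K) with hv
  have hv0 : 0 < v := by positivity
  refine ⟨v * r / 2, 1 / v, by positivity, by positivity, fun E θ hp h hcurv y hy x => ?_⟩
  have hvr : 0 < v * r := by positivity
  obtain ⟨s, hs, hsle, hsy, hd, hder⟩ := E.exists_dual_param hc h hr hrc hv0
    (hcv E θ hp h (E.inv_le_variance hc h hm hcurv)) y (by linarith)
  have hin : s ∈ interior (integrableExpSet (E.centred θ) (E.law θ)) :=
    h.mem_interior_integrableExpSet (hs.trans hrc)
  have hin0 : (0 : ℝ) ∈ interior (integrableExpSet (E.centred θ) (E.law θ)) :=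
    h.mem_interior_integrableExpSet (by simpa)
  have t1 := cgf_tangent_le hin
    (interior_subset hin0 : (0 : ℝ) ∈ integrableExpSet (E.centred θ) (E.law θ))
  have t2 := cgf_tangent_le hin0
    (interior_subset hin : s ∈ integrableExpSet (E.centred θ) (E.law θ))
  rw [cgf_zero, hsy] at t1
  rw [cgf_zero, E.deriv_cgf_centred_zero hc h] at t2
  have hcum := E.cumulant_add
    (interior_subset hin : s ∈ integrableExpSet (E.centred θ) (E.law θ))
  -- With θ + s the parameter dual to y, the cost minus `E.dual x` is ψ(θ + s) - x(θ + s). The term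
  -- `E.dual x` cancels whatever its value, even where the supremum is infinite.
  have e : bregman E.dual x y - E.dual x - (E.cumulant θ - x * θ) =
      cgf (E.centred θ) (E.law θ) s - (x - E.mean θ) * s := by
    rw [bregman, hder.deriv, hd, hcum]
    ring
  set a := |y - E.mean θ| with ha
  have hs1 : |s| ≤ 1 / v * a := by rw [one_div_mul_eq_div]; exact hsle
  have t3 : cgf (E.centred θ) (E.law θ) s ≤ |s| * a := by
    rw [ha, ← abs_mul]
    refine le_trans ?_ (le_abs_self _)
    linarith
  rw [e]
  calc _ ≤ |cgf (E.centred θ) (E.law θ) s| + |(x - E.mean θ) * s| := abs_sub _ _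
    _ ≤ |s| * a + |x - E.mean θ| * |s| := by
        rw [abs_mul, abs_of_nonneg (by linarith)]; linarith
    _ = |s| * (a + |x - E.mean θ|) := by ring
    _ ≤ _ := by gcongr

end ExpFamily

/-! ### Chernoff information and likelihood ratio tests. -/

section Chernoff

variable {S : Type*} [MeasurableSpace S] {ν : Measure S} {f g : S → ℝ}

lemma integrable_rpow_mul_rpow (hf : ∀ x, 0 ≤ f x) (hg : ∀ x, 0 ≤ g x) (hfi : Integrable f ν)
    (hgi : Integrable g ν) {t : ℝ} (ht : t ∈ Set.Ioo (0 : ℝ) 1) :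
    Integrable (fun x => f x ^ t * g x ^ (1 - t)) ν ∧
      ∫ x, f x ^ t * g x ^ (1 - t) ∂ν ≤ t * ∫ x, f x ∂ν + (1 - t) * ∫ x, g x ∂ν := by
  have hle : ∀ x, f x ^ t * g x ^ (1 - t) ≤ t * f x + (1 - t) * g x := fun x =>
    Real.geom_mean_le_arith_mean2_weighted ht.1.le (by linarith [ht.2]) (hf x) (hg x) (by ring)
  have hi := (hfi.const_mul t).add (hgi.const_mul (1 - t))
  have hfm := hfi.aemeasurable
  have hgm := hgi.aemeasurable
  have hI : Integrable (fun x => f x ^ t * g x ^ (1 - t)) ν := by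
    refine hi.mono' (AEMeasurable.aestronglyMeasurable (by fun_prop)) (ae_of_all _ fun x => ?_)
    rw [Real.norm_of_nonneg (mul_nonneg (Real.rpow_nonneg (hf x) _) (Real.rpow_nonneg (hg x) _))]
    exact hle x
  refine ⟨hI, ?_⟩
  rw [← integral_const_mul, ← integral_const_mul,
    ← integral_add (hfi.const_mul t) (hgi.const_mul (1 - t))]
  exact integral_mono hI hi hle

lemma integral_rpow_mul_rpow_nonneg (hf : ∀ x, 0 ≤ f x) (hg : ∀ x, 0 ≤ g x) (t : ℝ) :
    0 ≤ ∫ x, f x ^ t * g x ^ (1 - t) ∂ν :=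
  integral_nonneg fun x => mul_nonneg (Real.rpow_nonneg (hf x) _) (Real.rpow_nonneg (hg x) _)

lemma bddBelow_range_integral_rpow (hf : ∀ x, 0 ≤ f x) (hg : ∀ x, 0 ≤ g x) :
    BddBelow (Set.range fun t : Set.Ioo (0 : ℝ) 1 =>
      ∫ x, f x ^ (t : ℝ) * g x ^ (1 - (t : ℝ)) ∂ν) :=
  ⟨0, by rintro _ ⟨t, rfl⟩; exact integral_rpow_mul_rpow_nonneg hf hg t⟩

instance nonempty_Ioo_zero_one : Nonempty (Set.Ioo (0 : ℝ) 1) := ⟨⟨1 / 2, by norm_num⟩⟩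

lemma chernoff_nonneg (hf : ∀ x, 0 ≤ f x) (hg : ∀ x, 0 ≤ g x) (hfi : Integrable f ν)
    (hgi : Integrable g ν) (hf1 : ∫ x, f x ∂ν = 1) (hg1 : ∫ x, g x ∂ν = 1) :
    0 ≤ chernoff ν f g := by
  rw [chernoff, neg_nonneg]
  refine Real.log_nonpos (Real.iInf_nonneg fun t => integral_rpow_mul_rpow_nonneg hf hg t) ?_
  refine (ciInf_le (bddBelow_range_integral_rpow hf hg) (Classical.arbitrary _)).trans ?_
  refine (integrable_rpow_mul_rpow hf hg hfi hgi (Classical.arbitrary (Set.Ioo (0:ℝ) 1)).2).2.trans ?_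
  rw [hf1, hg1]
  linarith

lemma chernoff_le {B : ℝ} (h : ∀ t ∈ Set.Ioo (0 : ℝ) 1,
    Real.exp (-B) ≤ ∫ x, f x ^ t * g x ^ (1 - t) ∂ν) : chernoff ν f g ≤ B := by
  have h1 : Real.exp (-B) ≤ ⨅ t : Set.Ioo (0 : ℝ) 1,
      ∫ x, f x ^ (t : ℝ) * g x ^ (1 - (t : ℝ)) ∂ν := le_ciInf fun t => h t t.2
  have h2 := Real.log_le_log (Real.exp_pos _) h1
  rw [Real.log_exp] at h2
  rw [chernoff]
  linarith

/-- The error of a likelihood ratio test with threshold `exp s`. -/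
lemma withDensity_le_exp_sub_chernoff (hf : ∀ x, 0 ≤ f x) (hg : ∀ x, 0 ≤ g x)
    (hfm : Measurable f) (hgm : Measurable g) (hfi : Integrable f ν) (hgi : Integrable g ν)
    (hpos : 0 < chernoff ν f g) {s : ℝ} (hs : 0 ≤ s) :
    ν.withDensity (fun x => ENNReal.ofReal (g x)) {x | g x ≤ Real.exp s * f x} ≤
      ENNReal.ofReal (Real.exp (s - chernoff ν f g)) := by
  have hA : MeasurableSet {x | g x ≤ Real.exp s * f x} :=
    measurableSet_le hgm (hfm.const_mul _)
  rw [withDensity_apply _ hA, ← ofReal_integral_eq_lintegral_ofReal hgi.integrableOn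
    (ae_of_all _ hg)]
  refine ENNReal.ofReal_le_ofReal ?_
  -- On the error region the factor g^t of g = g^t g^(1-t) is at most (e^s f)^t; the slack costs at
  -- most e^s since t < 1.
  have hI : ∀ t ∈ Set.Ioo (0 : ℝ) 1,
      ∫ x in {x | g x ≤ Real.exp s * f x}, g x ∂ν ≤
        Real.exp s * ∫ x, f x ^ t * g x ^ (1 - t) ∂ν := by
    intro t ht
    have hi := ((integrable_rpow_mul_rpow hf hg hfi hgi ht).1).const_mul (Real.exp s)
    rw [← integral_const_mul]
    calc _ ≤ ∫ x in {x | g x ≤ Real.exp s * f x}, Real.exp s * (f x ^ t * g x ^ (1 - t)) ∂ν := by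
          refine setIntegral_mono_on hgi.integrableOn hi.integrableOn hA fun x hx => ?_
          have hx' : g x ≤ Real.exp s * f x := hx
          calc g x = g x ^ t * g x ^ (1 - t) := by
                rw [← Real.rpow_add' (hg x) (by norm_num)]; simp
            _ ≤ (Real.exp s * f x) ^ t * g x ^ (1 - t) := by
                refine mul_le_mul_of_nonneg_right ?_ (Real.rpow_nonneg (hg x) _)
                exact Real.rpow_le_rpow (hg x) hx' ht.1.le
            _ = Real.exp (s * t) * (f x ^ t * g x ^ (1 - t)) := by
                rw [Real.mul_rpow (Real.exp_pos _).le (hf x), ← Real.exp_mul]; ring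
            _ ≤ _ := by
                refine mul_le_mul_of_nonneg_right (Real.exp_le_exp.2 ?_)
                  (mul_nonneg (Real.rpow_nonneg (hf x) _) (Real.rpow_nonneg (hg x) _))
                nlinarith [ht.2]
      _ ≤ _ := setIntegral_le_integral hi (ae_of_all _ fun x => mul_nonneg (Real.exp_pos _).le
          (mul_nonneg (Real.rpow_nonneg (hf x) _) (Real.rpow_nonneg (hg x) _)))
  set J := ⨅ t : Set.Ioo (0 : ℝ) 1, ∫ x, f x ^ (t : ℝ) * g x ^ (1 - (t : ℝ)) ∂ν with hJ
  have hJ0 : 0 ≤ J := Real.iInf_nonneg fun t => integral_rpow_mul_rpow_nonneg hf hg t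
  have hch : chernoff ν f g = -Real.log J := rfl
  -- A vanishing infimum would make the Chernoff information 0, as `Real.log 0 = 0`; positivity
  -- rules this out.
  have hJpos : 0 < J := by
    refine hJ0.lt_of_ne fun h => ?_
    rw [hch, ← h] at hpos
    simp at hpos
  have h1 : (∫ x in {x | g x ≤ Real.exp s * f x}, g x ∂ν) / Real.exp s ≤ J :=
    le_ciInf fun t => by
      rw [div_le_iff₀' (Real.exp_pos _)]
      exact hI t t.2
  rw [div_le_iff₀' (Real.exp_pos _)] at h1
  rwa [hch, sub_neg_eq_add, Real.exp_add, Real.exp_log hJpos]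

end Chernoff

/-! ### Normalization of the densities and a bound on the Hellinger-type integrals. -/

namespace ExpFamily

variable (E : ExpFamily) {θ : ℝ}

instance sigmaFinite_law (θ : ℝ) : SigmaFinite (E.law θ) :=
  SigmaFinite.withDensity_ofReal _

/-- Mass 0 is the degenerate case of a vanishing normalizer, where no choice of cumulant can
normalize the density. -/
lemma law_univ (hθ : θ ∈ E.natParam) : E.law θ Set.univ = 0 ∨ E.law θ Set.univ = 1 := by
  have h1 : E.law θ Set.univ = ENNReal.ofReal (∫ x, E.pdf θ x ∂E.ref) := by
    rw [law, withDensity_apply _ MeasurableSet.univ, Measure.restrict_univ,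
      ← ofReal_integral_eq_lintegral_ofReal (E.integrable_pdf hθ) (ae_of_all _ (E.pdf_nonneg θ))]
  simp only [pdf_eq, integral_const_mul] at h1
  have h0 : 0 ≤ ∫ x, E.h x * Real.exp (E.u x * θ) ∂E.ref :=
    integral_nonneg fun x => mul_nonneg (E.h_nonneg x) (Real.exp_pos _).le
  rcases h0.eq_or_lt with h | h
  · left; rw [h1, ← h]; simp
  · right
    rw [h1, cumulant, Real.exp_neg, Real.exp_log h, inv_mul_cancel₀ h.ne', ENNReal.ofReal_one]

lemma integral_pos_of_mem [IsProbabilityMeasure (E.law θ)] {θ' : ℝ} (h : θ' ∈ E.natParam) :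
    0 < ∫ x, E.h x * Real.exp (E.u x * θ') ∂E.ref := by
  have hs : θ' - θ ∈ integrableExpSet (E.centred θ) (E.law θ) := by
    rw [mem_integrableExpSet_centred_iff]; simpa using h
  have hpos : 0 < mgf (E.centred θ) (E.law θ) (θ' - θ) := mgf_pos hs
  rw [mgf, integral_law] at hpos
  simp only [exp_centred_mul_pdf, integral_const_mul, add_sub_cancel] at hpos
  exact (pos_iff_pos_of_mul_pos hpos).1 (Real.exp_pos _)

lemma integral_pdf [IsProbabilityMeasure (E.law θ)] {θ' : ℝ} (h : θ' ∈ E.natParam) :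
    ∫ x, E.pdf θ' x ∂E.ref = 1 := by
  have hp := E.integral_pos_of_mem (θ := θ) h
  simp only [pdf_eq, integral_const_mul]
  rw [cumulant, Real.exp_neg, Real.exp_log hp, inv_mul_cancel₀ hp.ne']

lemma cumulant_tangent_le [IsProbabilityMeasure (E.law θ)] {c K : ℝ} (hc : 0 < c)
    (h : HasExpMoment (E.law θ) (E.centred θ) c K) {θ' : ℝ} (hθ' : θ' ∈ E.natParam) :
    E.cumulant θ + (θ' - θ) * E.mean θ ≤ E.cumulant θ' := by
  have hs : θ' - θ ∈ integrableExpSet (E.centred θ) (E.law θ) := by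
    rw [mem_integrableExpSet_centred_iff]; simpa using hθ'
  have h1 := E.cumulant_add hs
  have h2 := cgf_tangent_le (h.mem_interior_integrableExpSet (s := 0) (by simpa)) hs
  rw [cgf_zero, E.deriv_cgf_centred_zero hc h] at h2
  rw [add_sub_cancel] at h1
  linarith

lemma convex_natParam [IsProbabilityMeasure (E.law θ)] : Convex ℝ E.natParam := by
  have h := convex_integrableExpSet (X := E.centred θ) (μ := E.law θ)
  have e : E.natParam = (fun x => θ + x) '' integrableExpSet (E.centred θ) (E.law θ) := by
    ext x
    constructor
    · exact fun hx => ⟨x - θ, (E.mem_integrableExpSet_centred_iff _ _).2 (by simpa using hx),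
        by simp⟩
    · rintro ⟨s, hs, rfl⟩
      exact (E.mem_integrableExpSet_centred_iff _ _).1 hs
  rw [e]
  exact h.translate θ

/-- At the midpoint of a and b, compare the upper bound from strong convexity with the average of
the tangent lines at a and b, whose slopes are the means. -/
lemma strongConvexOn_cumulant_gap {A : Set ℝ} {m : ℝ} (hA : StrongConvexOn A m E.cumulant)
    {a b c K : ℝ} (hc : 0 < c) (ha : a ∈ A) (hb : b ∈ A) (ha' : a ∈ E.natParam)
    (hb' : b ∈ E.natParam)
    [IsProbabilityMeasure (E.law a)] [IsProbabilityMeasure (E.law b)]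
    (hma : HasExpMoment (E.law a) (E.centred a) c K)
    (hmb : HasExpMoment (E.law b) (E.centred b) c K) :
    m / 2 * (a - b) ^ 2 ≤ (E.mean a - E.mean b) * (a - b) := by
  have h1 := hA.2 ha hb (by norm_num : (0 : ℝ) ≤ 1 / 2) (by norm_num : (0 : ℝ) ≤ 1 / 2)
    (by norm_num)
  simp only [smul_eq_mul, Real.norm_eq_abs, sq_abs] at h1
  have hmid : 1 / 2 * a + 1 / 2 * b ∈ E.natParam := by
    have := (E.convex_natParam (θ := a)) ha' hb' (by norm_num : (0 : ℝ) ≤ 1 / 2)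
      (by norm_num : (0 : ℝ) ≤ 1 / 2) (by norm_num)
    simpa using this
  have h2 := E.cumulant_tangent_le hc hma hmid
  have h3 := E.cumulant_tangent_le hc hmb hmid
  nlinarith

lemma rpow_pdf_mul_rpow_pdf (a b x : ℝ) {t : ℝ} :
    E.pdf a x ^ t * E.pdf b x ^ (1 - t) =
      Real.exp (E.cumulant (b + t * (a - b)) - t * E.cumulant a - (1 - t) * E.cumulant b) *
        E.pdf (b + t * (a - b)) x := by
  unfold pdf
  rw [Real.mul_rpow (E.h_nonneg x) (Real.exp_pos _).le,
    Real.mul_rpow (E.h_nonneg x) (Real.exp_pos _).le, ← Real.exp_mul, ← Real.exp_mul]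
  have hh : E.h x ^ t * E.h x ^ (1 - t) = E.h x := by
    rw [← Real.rpow_add' (E.h_nonneg x) (by norm_num)]; simp
  rw [mul_mul_mul_comm, hh, mul_left_comm (Real.exp _) (E.h x), ← Real.exp_add, ← Real.exp_add]
  ring_nf

/-- A geometric mixture of two members is a multiple of a third, so the integral is an exponential
of a convexity gap of ψ. Tangents at a and b bound that gap by t(1-t) times the product of parameter
gap and mean gap, and the former is at most 2/m times the latter. -/
lemma exp_le_integral_rpow_pdf {m : ℝ} (hm : 0 < m) {a b c K D : ℝ} (hc : 0 < c)
    (ha' : a ∈ E.natParam) (hb' : b ∈ E.natParam)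
    [IsProbabilityMeasure (E.law a)] [IsProbabilityMeasure (E.law b)]
    (hma : HasExpMoment (E.law a) (E.centred a) c K)
    (hmb : HasExpMoment (E.law b) (E.centred b) c K)
    (hgap : m / 2 * (a - b) ^ 2 ≤ (E.mean a - E.mean b) * (a - b))
    (hD : |E.mean a - E.mean b| ≤ D) {t : ℝ} (ht : t ∈ Set.Ioo (0 : ℝ) 1) :
    Real.exp (-(2 / m * D ^ 2)) ≤ ∫ x, E.pdf a x ^ t * E.pdf b x ^ (1 - t) ∂E.ref := by
  have hmid : b + t * (a - b) ∈ E.natParam := by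
    have := (E.convex_natParam (θ := a)) ha' hb' ht.1.le (by linarith [ht.2] : 0 ≤ 1 - t)
      (by ring)
    simp only [smul_eq_mul] at this
    convert this using 1
    ring
  simp only [rpow_pdf_mul_rpow_pdf, integral_const_mul]
  rw [E.integral_pdf (θ := a) hmid, mul_one, Real.exp_le_exp]
  have h2 := E.cumulant_tangent_le hc hma hmid
  have h3 := E.cumulant_tangent_le hc hmb hmid
  set p := a - b
  set q := E.mean a - E.mean b with hq
  have h4 : p * q ≤ 2 / m * q ^ 2 := by
    rw [div_mul_eq_mul_div, le_div_iff₀ hm]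
    nlinarith [sq_nonneg (q - m / 2 * p)]
  have h5 : q ^ 2 ≤ D ^ 2 := by
    rw [← sq_abs]
    gcongr
  have h6 : 2 / m * q ^ 2 ≤ 2 / m * D ^ 2 := by gcongr
  have hpq : 0 ≤ p * q := by nlinarith [sq_nonneg p]
  have h7 : t * (1 - t) * (p * q) ≤ 1 * (p * q) := by
    refine mul_le_mul_of_nonneg_right ?_ hpq
    nlinarith [ht.1, ht.2]
  have h8 := mul_le_mul_of_nonneg_left h2 ht.1.le
  have h9 := mul_le_mul_of_nonneg_left h3 (by linarith [ht.2] : 0 ≤ 1 - t)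
  have e : b + t * p - a = -(1 - t) * p := by ring
  rw [e] at h8
  have e2 : b + t * p - b = t * p := by ring
  rw [e2] at h9
  nlinarith

end ExpFamily

/-! ### Product densities. -/

section Product

variable {d : ℕ} (E : Fin d → ExpFamily) {θ : Fin d → ℝ}

/-- The law of a point with independent coordinates drawn from members of the families. -/
noncomputable def productLaw (θ : Fin d → ℝ) : Measure (Fin d → ℝ) :=
  (productRef E).withDensity (fun x => ENNReal.ofReal (productPdf E θ x))

lemma productPdf_nonneg (θ x : Fin d → ℝ) : 0 ≤ productPdf E θ x :=
  Finset.prod_nonneg fun l _ => (E l).pdf_nonneg _ _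

@[fun_prop]
lemma measurable_productPdf (θ : Fin d → ℝ) : Measurable (productPdf E θ) := by
  unfold productPdf
  fun_prop

lemma integrable_productPdf (hθ : ∀ l, θ l ∈ (E l).natParam) :
    Integrable (productPdf E θ) (productRef E) :=
  Integrable.fintype_prod_dep fun l => (E l).integrable_pdf (hθ l)

lemma productLaw_eq_pi (hθ : ∀ l, θ l ∈ (E l).natParam) :
    productLaw E θ = Measure.pi fun l => (E l).law (θ l) := by
  refine (Measure.pi_eq fun s hs => ?_).symm
  rw [productLaw, withDensity_apply _ (MeasurableSet.univ_pi hs), productRef,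
    Measure.restrict_pi_pi, ← ofReal_integral_eq_lintegral_ofReal]
  · simp only [productPdf]
    rw [integral_fintype_prod_eq_prod, ENNReal.ofReal_prod_of_nonneg]
    · refine Finset.prod_congr rfl fun l _ => ?_
      rw [ExpFamily.law, withDensity_apply _ (hs l), ← ofReal_integral_eq_lintegral_ofReal
        ((E l).integrable_pdf (hθ l)).integrableOn (ae_of_all _ ((E l).pdf_nonneg _))]
    · exact fun l _ => integral_nonneg fun x => (E l).pdf_nonneg _ _
  · exact Integrable.fintype_prod_dep fun l => ((E l).integrable_pdf (hθ l)).integrableOn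
  · exact ae_of_all _ fun x => productPdf_nonneg E θ x

/-- Every factor has mass 0 or 1, and the masses multiply to 1. -/
lemma isProbabilityMeasure_law_of_productLaw (hθ : ∀ l, θ l ∈ (E l).natParam)
    (h : IsProbabilityMeasure (productLaw E θ)) (l : Fin d) :
    IsProbabilityMeasure ((E l).law (θ l)) := by
  have h1 := h.measure_univ
  rw [productLaw_eq_pi E hθ, Measure.pi_univ] at h1
  refine ⟨((E l).law_univ (hθ l)).resolve_left fun h0 => ?_⟩
  rw [Finset.prod_eq_zero (Finset.mem_univ l) h0] at h1
  exact zero_ne_one h1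

lemma integral_productPdf (hθ : ∀ l, θ l ∈ (E l).natParam)
    (h : ∀ l, IsProbabilityMeasure ((E l).law (θ l))) :
    ∫ x, productPdf E θ x ∂(productRef E) = 1 := by
  simp only [productPdf, productRef]
  rw [integral_fintype_prod_eq_prod]
  exact Finset.prod_eq_one fun l _ => (E l).integral_pdf (θ := θ l) (hθ l)

lemma map_eval_productLaw (hθ : ∀ l, θ l ∈ (E l).natParam)
    (h : ∀ l, IsProbabilityMeasure ((E l).law (θ l))) (l : Fin d) :
    HasLaw (fun x : Fin d → ℝ => x l) ((E l).law (θ l)) (productLaw E θ) := by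
  rw [productLaw_eq_pi E hθ]
  exact ⟨(measurable_pi_apply l).aemeasurable,
    (measurePreserving_eval (fun l => (E l).law (θ l)) l).map_eq⟩

lemma productLaw_sum_abs_ge_le (hθ : ∀ l, θ l ∈ (E l).natParam)
    (h : ∀ l, IsProbabilityMeasure ((E l).law (θ l))) {c K : ℝ} (hc : 0 ≤ c)
    (hm : ∀ l, HasExpMoment ((E l).law (θ l)) ((E l).centred (θ l)) c K) (s : ℝ) :
    productLaw E θ {x | s ≤ ∑ l, |(E l).centred (θ l) (x l)|} ≤
      ENNReal.ofReal (K ^ d * Real.exp (-c * s)) := by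
  rw [productLaw_eq_pi E hθ]
  set π := Measure.pi fun l => (E l).law (θ l) with hπ
  have e : (fun x : Fin d → ℝ => Real.exp (c * ∑ l, |(E l).centred (θ l) (x l)|)) =
      fun x => ∏ l, Real.exp (c * |(E l).centred (θ l) (x l)|) := by
    ext x
    rw [Finset.mul_sum, Real.exp_sum]
  have hi : Integrable (fun x : Fin d → ℝ =>
      Real.exp (c * ∑ l, |(E l).centred (θ l) (x l)|)) π := by
    rw [e]
    exact Integrable.fintype_prod_dep fun l => (hm l).integrable
  have h1 := measure_ge_le_exp_mul_mgf s hc hi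
  rw [← ofReal_measureReal]
  refine ENNReal.ofReal_le_ofReal (h1.trans ?_)
  rw [mul_comm]
  refine mul_le_mul_of_nonneg_right ?_ (Real.exp_pos _).le
  rw [mgf, e, hπ, integral_fintype_prod_eq_prod (fun l y => Real.exp (c * |(E l).centred (θ l) y|))]
  calc _ ≤ ∏ l : Fin d, K := Finset.prod_le_prod
        (fun l _ => integral_nonneg fun x => (Real.exp_pos _).le) fun l _ => (hm l).integral_le
    _ = K ^ d := by simp

lemma chernoff_productPdf_le {θ' : Fin d → ℝ} (hθ : ∀ l, θ l ∈ (E l).natParam)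
    (hθ' : ∀ l, θ' l ∈ (E l).natParam)
    (h : ∀ l, IsProbabilityMeasure ((E l).law (θ l)))
    (h' : ∀ l, IsProbabilityMeasure ((E l).law (θ' l))) {c K m D : ℝ} (hc : 0 < c) (hm : 0 < m)
    (hE : ∀ l, HasExpMoment ((E l).law (θ l)) ((E l).centred (θ l)) c K)
    (hE' : ∀ l, HasExpMoment ((E l).law (θ' l)) ((E l).centred (θ' l)) c K)
    (hgap : ∀ l, m / 2 * (θ l - θ' l) ^ 2 ≤
      ((E l).mean (θ l) - (E l).mean (θ' l)) * (θ l - θ' l))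
    (hD : ∀ l, |(E l).mean (θ l) - (E l).mean (θ' l)| ≤ D) :
    chernoff (productRef E) (productPdf E θ) (productPdf E θ') ≤ d * (2 / m * D ^ 2) := by
  refine chernoff_le fun t ht => ?_
  have e : ∀ x : Fin d → ℝ, productPdf E θ x ^ t * productPdf E θ' x ^ (1 - t) =
      ∏ l, ((E l).pdf (θ l) (x l) ^ t * (E l).pdf (θ' l) (x l) ^ (1 - t)) := fun x => by
    rw [productPdf, productPdf, ← Real.finsetProd_rpow _ _ fun l _ => (E l).pdf_nonneg _ _,
      ← Real.finsetProd_rpow _ _ fun l _ => (E l).pdf_nonneg _ _, Finset.prod_mul_distrib]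
  simp only [e, productRef]
  rw [integral_fintype_prod_eq_prod
    (fun l y => (E l).pdf (θ l) y ^ t * (E l).pdf (θ' l) y ^ (1 - t))]
  calc Real.exp (-(d * (2 / m * D ^ 2))) = ∏ l : Fin d, Real.exp (-(2 / m * D ^ 2)) := by
        rw [Finset.prod_const, ← Real.exp_nat_mul]; simp
    _ ≤ _ := Finset.prod_le_prod (fun l _ => (Real.exp_pos _).le) fun l _ => by
        have := h l
        have := h' l
        exact (E l).exp_le_integral_rpow_pdf hm hc (hθ l) (hθ' l) (hE l) (hE' l) (hgap l) (hD l) ht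

end Product

/-! ### One iteration, for fixed data. -/

section Deterministic

variable {n k d : ℕ} (E : Fin d → ExpFamily) (θ : Fin k → Fin d → ℝ)

lemma cluster_comp_perm (τ : Equiv.Perm (Fin k)) (z : Fin n → Fin k) (a : Fin k) :
    cluster (τ ∘ z) (τ a) = cluster z a := by
  ext i
  simp [cluster]

/-- Equivariance under relabelling: the permutation optimal for the initial labelling can be kept
throughout, so the loss may be treated as a Hamming distance. -/
lemma IsBregmanStep.comp_perm {E : Fin d → ExpFamily} {x : Fin n → Fin d → ℝ}
    {z z' : Fin n → Fin k} (h : IsBregmanStep E x z z') (τ : Equiv.Perm (Fin k)) :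
    IsBregmanStep E x (τ ∘ z) (τ ∘ z') := by
  have e : ∀ y a, bregmanCost E x (τ ∘ z) y (τ a) = bregmanCost E x z y a := fun y a => by
    simp only [bregmanCost, empMean, cluster_comp_perm]
  intro i a
  obtain ⟨b, rfl⟩ := τ.surjective a
  rw [Function.comp_apply, e, e]
  exact h i b

lemma exists_perm_labelLoss_eq (z z' : Fin n → Fin k) :
    ∃ τ : Equiv.Perm (Fin k), labelLoss z z' = hammingDist z (τ ∘ z') := by
  obtain ⟨τ, hτ⟩ := Nat.sInf_mem
    (Set.range_nonempty fun τ : Equiv.Perm (Fin k) => hammingDist z (τ ∘ z'))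
  exact ⟨τ, hτ.symm⟩

lemma labelLoss_le_hammingDist (z z' : Fin n → Fin k) (τ : Equiv.Perm (Fin k)) :
    labelLoss z z' ≤ hammingDist z (τ ∘ z') :=
  Nat.sInf_le ⟨τ, rfl⟩

/-- If one iteration started near the truth misclassifies only points of a fixed small set, then
so do all later ones. -/
lemma labelLoss_le_card_of_step {x : Fin n → Fin d → ℝ} {zs : Fin n → Fin k} {B : Finset (Fin n)}
    {L : ℝ} (hB : (B.card : ℝ) ≤ L)
    (hstep : ∀ z z' : Fin n → Fin k, IsBregmanStep E x z z' → (hammingDist zs z : ℝ) ≤ L →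
      ∀ i, z' i ≠ zs i → i ∈ B)
    {z : ℕ → Fin n → Fin k} (hz : ∀ t, IsBregmanStep E x (z t) (z (t + 1)))
    (h0 : (labelLoss zs (z 0) : ℝ) ≤ L) : ∀ t, 1 ≤ t → labelLoss zs (z t) ≤ B.card := by
  obtain ⟨τ, hτ⟩ := exists_perm_labelLoss_eq zs (z 0)
  have key : ∀ t, (hammingDist zs (τ ∘ z t) : ℝ) ≤ L →
      hammingDist zs (τ ∘ z (t + 1)) ≤ B.card := by
    intro t ht
    refine Finset.card_le_card fun i hi => ?_
    refine hstep _ _ ((hz t).comp_perm τ) ht i ?_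
    simpa [eq_comm] using hi
  have hall : ∀ t, hammingDist zs (τ ∘ z (t + 1)) ≤ B.card := by
    intro t
    induction t with
    | zero => exact key 0 (hτ ▸ h0)
    | succ t ih => exact key _ (le_trans (by exact_mod_cast ih) hB)
  intro t ht
  obtain ⟨s, rfl⟩ := Nat.exists_eq_add_of_le' ht
  exact (labelLoss_le_hammingDist _ _ τ).trans (hall s)

lemma sum_cluster_eq (z : Fin n → Fin k) (a : Fin k) (f : Fin n → ℝ) :
    ∑ i ∈ cluster z a, f i = ∑ i, if z i = a then f i else 0 := by
  rw [cluster, Finset.sum_filter]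

/-- A mislabelled point changes a cluster sum by at most |w| + Δ, and |w| is at most T plus its
excess over T. The hypotheses `h1` and `h2` on the data do not involve z, so one good event serves
every labelling close to the truth. Here N stands for n/k. -/
lemma abs_empMean_sub_le {x : Fin n → Fin d → ℝ} {zs z : Fin n → Fin k} {Δ T α ε N : ℝ}
    (hΔ : ∀ a b l, |(E l).mean (θ a l) - (E l).mean (θ b l)| ≤ Δ)
    (hα : 0 < α) (hN : 0 < N) (hε : 0 ≤ ε)
    (hcard : ∀ a, α * N ≤ ((cluster zs a).card : ℝ))
    (hL : (hammingDist zs z : ℝ) ≤ α * N / 2) (hLΔ : (hammingDist zs z : ℝ) * Δ ≤ ε * N)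
    (hLT : (hammingDist zs z : ℝ) * T ≤ ε * N)
    (h1 : ∀ a l, |∑ i ∈ cluster zs a, (E l).centred (θ (zs i) l) (x i l)| ≤
      ε * (cluster zs a).card)
    (h2 : ∀ l, ∑ i, max (|(E l).centred (θ (zs i) l) (x i l)| - T) 0 ≤ ε * N) (a : Fin k)
    (l : Fin d) : |empMean E x z a l - (E l).mean (θ a l)| ≤ 2 * (ε + 3 * ε / α) := by
  have hΔ0 : 0 ≤ Δ := by simpa using hΔ a a l
  set w : Fin n → ℝ := fun i => (E l).centred (θ (zs i) l) (x i l) with hw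
  set D : Finset (Fin n) := Finset.univ.filter fun i => zs i ≠ z i with hD
  have hDc : (D.card : ℝ) = hammingDist zs z := rfl
  set m := ((cluster z a).card : ℝ) with hm
  set m0 := ((cluster zs a).card : ℝ) with hm0
  have hm0m : m0 ≤ m + hammingDist zs z := by
    rw [← hDc, hm, hm0]
    have hsub : cluster zs a ⊆ cluster z a ∪ D := by
      intro i hi
      simp only [cluster, Finset.mem_filter, Finset.mem_univ, true_and, Finset.mem_union, hD] at *
      by_cases h : zs i = z i
      · left; rw [← h, hi]
      · right; exact h
    exact_mod_cast (Finset.card_le_card hsub).trans (Finset.card_union_le _ _)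
  have hca : α * N ≤ m0 := hcard a
  have hαN : 0 < α * N := mul_pos hα hN
  have hm2 : m0 / 2 ≤ m := by linarith
  have hmpos : 0 < m := by linarith
  have hsum : m * (empMean E x z a l - (E l).mean (θ a l)) =
      ∑ i ∈ cluster z a, ((E l).u (x i l) - (E l).mean (θ a l)) := by
    rw [Finset.sum_sub_distrib, Finset.sum_const, nsmul_eq_mul, mul_sub, empMean,
      mul_div_cancel₀ _ hmpos.ne']
  have hdiff : |∑ i ∈ cluster z a, ((E l).u (x i l) - (E l).mean (θ a l)) -
      ∑ i ∈ cluster zs a, w i| ≤ ∑ i ∈ D, (|w i| + Δ) := by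
    rw [sum_cluster_eq, sum_cluster_eq, ← Finset.sum_sub_distrib, hD, Finset.sum_filter]
    refine (Finset.abs_sum_le_sum_abs _ _).trans (Finset.sum_le_sum fun i _ => ?_)
    have hwi : (E l).u (x i l) = w i + (E l).mean (θ (zs i) l) := by
      simp [hw, ExpFamily.centred]
    by_cases h : zs i = z i
    · rw [← h]
      by_cases h' : zs i = a
      · simp [h', hwi]
      · simp [h']
    · rw [if_pos h]
      by_cases h' : zs i = a
      · rw [if_pos h', if_neg (fun h'' => h (h'.trans h''.symm)), zero_sub, abs_neg]
        linarith
      · rw [if_neg h', sub_zero]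
        split_ifs
        · rw [hwi, add_sub_assoc]
          exact (abs_add_le _ _).trans (by gcongr; exact hΔ _ _ _)
        · rw [abs_zero]; positivity
  have hDsum : ∑ i ∈ D, (|w i| + Δ) ≤ 3 * ε * N := by
    calc ∑ i ∈ D, (|w i| + Δ) ≤ ∑ i ∈ D, (max (|w i| - T) 0 + (T + Δ)) := by
          refine Finset.sum_le_sum fun i _ => ?_
          linarith [le_max_left (|w i| - T) 0]
      _ = ∑ i ∈ D, max (|w i| - T) 0 + D.card * (T + Δ) := by
          rw [Finset.sum_add_distrib, Finset.sum_const, nsmul_eq_mul]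
      _ ≤ ∑ i, max (|w i| - T) 0 + D.card * (T + Δ) := by
          refine add_le_add_left ?_ _
          exact Finset.sum_le_sum_of_subset_of_nonneg (Finset.subset_univ _)
            fun i _ _ => le_max_right _ _
      _ ≤ 3 * ε * N := by
          rw [hDc]
          linarith [h2 l]
  have htot : m * |empMean E x z a l - (E l).mean (θ a l)| ≤ ε * m0 + 3 * ε * N := by
    nth_rw 1 [← abs_of_pos hmpos]
    rw [← abs_mul, hsum]
    have := h1 a l
    have h3 := abs_add_le (∑ i ∈ cluster z a, ((E l).u (x i l) - (E l).mean (θ a l)) -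
      ∑ i ∈ cluster zs a, w i) (∑ i ∈ cluster zs a, w i)
    rw [sub_add_cancel] at h3
    linarith
  refine le_of_mul_le_mul_left (htot.trans ?_) hmpos
  have e1 : ε * m0 ≤ m * (2 * ε) := by nlinarith
  have e2 : 3 * ε * N ≤ m * (2 * (3 * ε / α)) := by
    have : α * N ≤ 2 * m := by linarith
    have h3 : 3 * ε / α * (α * N) = 3 * ε * N := by field_simp
    rw [← h3]
    have h4 : 0 ≤ 3 * ε / α := by positivity
    nlinarith
  linarith

/-- The chosen label has the smallest cost, and costs are negative log-likelihoods up to the error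
of `hbreg` and a term independent of the label. Deviations from the mean of the chosen label are
compared with those from the true mean at the price of Δ per coordinate. -/
lemma productPdf_le_of_step {x : Fin n → Fin d → ℝ} {zs z z' : Fin n → Fin k} {Δ ρ r L s : ℝ}
    (hL : 0 ≤ L) (hρ0 : 0 ≤ ρ) (hρ : ρ ≤ r)
    (hΔ : ∀ a b l, |(E l).mean (θ a l) - (E l).mean (θ b l)| ≤ Δ)
    (hbreg : ∀ a l y, |y - (E l).mean (θ a l)| ≤ r → ∀ x,
      |bregman (E l).dual x y - (E l).dual x - ((E l).cumulant (θ a l) - x * θ a l)| ≤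
        L * |y - (E l).mean (θ a l)| * (|y - (E l).mean (θ a l)| + |x - (E l).mean (θ a l)|))
    (hmean : ∀ a l, |empMean E x z a l - (E l).mean (θ a l)| ≤ ρ)
    (hstep : IsBregmanStep E x z z') (i : Fin n)
    (hs : L * ρ * (d * (2 * ρ + Δ) + 2 * ∑ l, |(E l).centred (θ (zs i) l) (x i l)|) ≤ s) :
    productPdf E (θ (zs i)) (x i) ≤ Real.exp s * productPdf E (θ (z' i)) (x i) := by
  have hcost : ∀ b, |bregmanCost E x z (x i) b - ∑ l, ((E l).dual ((E l).u (x i l)) +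
      ((E l).cumulant (θ b l) - (E l).u (x i l) * θ b l))| ≤
      ∑ l, L * ρ * (ρ + |(E l).u (x i l) - (E l).mean (θ b l)|) := by
    intro b
    rw [bregmanCost, ← Finset.sum_sub_distrib]
    refine (Finset.abs_sum_le_sum_abs _ _).trans (Finset.sum_le_sum fun l _ => ?_)
    rw [← sub_sub]
    refine (hbreg b l _ ((hmean b l).trans hρ) _).trans ?_
    gcongr <;> exact hmean b l
  have h1 := abs_le.1 (hcost (zs i))
  have h2 := abs_le.1 (hcost (z' i))
  have h3 := hstep i (zs i)
  have e1 : ∑ l, L * ρ * (ρ + |(E l).u (x i l) - (E l).mean (θ (zs i) l)|) =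
      L * ρ * (d * ρ + ∑ l, |(E l).centred (θ (zs i) l) (x i l)|) := by
    rw [← Finset.mul_sum, Finset.sum_add_distrib, Finset.sum_const, nsmul_eq_mul]
    simp [ExpFamily.centred]
  have e2 : ∑ l, L * ρ * (ρ + |(E l).u (x i l) - (E l).mean (θ (z' i) l)|) ≤
      L * ρ * (d * (ρ + Δ) + ∑ l, |(E l).centred (θ (zs i) l) (x i l)|) := by
    rw [← Finset.mul_sum]
    refine mul_le_mul_of_nonneg_left ?_ (by positivity)
    calc _ ≤ ∑ l, ((ρ + Δ) + |(E l).centred (θ (zs i) l) (x i l)|) := by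
          refine Finset.sum_le_sum fun l _ => ?_
          have := abs_add_le ((E l).u (x i l) - (E l).mean (θ (zs i) l))
            ((E l).mean (θ (zs i) l) - (E l).mean (θ (z' i) l))
          rw [sub_add_sub_cancel] at this
          have := hΔ (zs i) (z' i) l
          rw [ExpFamily.centred]
          linarith
      _ = _ := by
          rw [Finset.sum_add_distrib, Finset.sum_const, nsmul_eq_mul]
          simp
  rw [Finset.sum_add_distrib] at h1 h2
  have h4 : ∑ l, ((E l).cumulant (θ (z' i) l) - (E l).u (x i l) * θ (z' i) l) ≤
      ∑ l, ((E l).cumulant (θ (zs i) l) - (E l).u (x i l) * θ (zs i) l) + s := by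
    nlinarith
  have e3 : ∀ b, productPdf E (θ b) (x i) = (∏ l, (E l).h (x i l)) *
      Real.exp (-∑ l, ((E l).cumulant (θ b l) - (E l).u (x i l) * θ b l)) := fun b => by
    simp only [productPdf, ExpFamily.pdf]
    rw [Finset.prod_mul_distrib, ← Real.exp_sum, ← Finset.sum_neg_distrib]
    simp
  rw [e3, e3, mul_left_comm, ← Real.exp_add]
  refine mul_le_mul_of_nonneg_left (Real.exp_le_exp.2 (by linarith))
    (Finset.prod_nonneg fun l _ => (E l).h_nonneg _)

end Deterministic

/-! ### Markov, Bernstein and excess bounds. -/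

section Concentration

variable {Ω : Type*} [MeasurableSpace Ω] {P : Measure Ω}

/-- Markov's inequality for the number of occurrences among finitely many (not necessarily
measurable) events. -/
lemma measure_card_gt_le {n : ℕ} (A : Fin n → Set Ω) {p q : ℝ} (hq : 0 < q)
    (hA : ∀ i, P (A i) ≤ ENNReal.ofReal p) :
    P {ω | ∀ B : Finset (Fin n), (∀ i, ω ∈ A i → i ∈ B) → n * q < B.card} ≤
      ENNReal.ofReal (p / q) := by
  classical
  rcases Nat.eq_zero_or_pos n with rfl | hn
  · have : {ω : Ω | ∀ B : Finset (Fin 0), (∀ i, ω ∈ A i → i ∈ B) → ((0 : ℕ) : ℝ) * q < B.card} =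
        ∅ := by
      ext ω
      simp only [Set.mem_ofPred_eq, Set.mem_empty_iff_false, iff_false, not_forall]
      exact ⟨∅, by simp, by simp⟩
    rw [this]
    simp
  have hn' : (0 : ℝ) < n := by exact_mod_cast hn
  -- Counting measurable hulls of the events instead does not change their measure.
  set F : Ω → ENNReal := fun ω => ∑ i, (toMeasurable P (A i)).indicator 1 ω with hF
  have hFm : Measurable F := Finset.measurable_sum _ fun i _ =>
    measurable_one.indicator (measurableSet_toMeasurable _ _)
  have hint : ∫⁻ ω, F ω ∂P ≤ ENNReal.ofReal (n * p) := by
    rw [hF, lintegral_finsetSum _ fun i _ =>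
      measurable_one.indicator (measurableSet_toMeasurable _ _)]
    calc _ = ∑ i, P (A i) := Finset.sum_congr rfl fun i _ => by
          rw [lintegral_indicator_one (measurableSet_toMeasurable _ _), measure_toMeasurable]
      _ ≤ ∑ i : Fin n, ENNReal.ofReal p := Finset.sum_le_sum fun i _ => hA i
      _ = _ := by
          rw [Finset.sum_const, Finset.card_univ, Fintype.card_fin, nsmul_eq_mul,
            ENNReal.ofReal_mul hn'.le, ENNReal.ofReal_natCast]
  have hsub : {ω | ∀ B : Finset (Fin n), (∀ i, ω ∈ A i → i ∈ B) → n * q < B.card} ⊆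
      {ω | ENNReal.ofReal (n * q) ≤ F ω} := by
    intro ω hω
    have h1 := hω (Finset.univ.filter fun i => ω ∈ toMeasurable P (A i)) fun i hi => by
      simpa using subset_toMeasurable P (A i) hi
    have h2 : F ω = ((Finset.univ.filter fun i => ω ∈ toMeasurable P (A i)).card : ENNReal) := by
      rw [hF, Finset.card_filter]
      push_cast
      refine Finset.sum_congr rfl fun i _ => ?_
      simp [Set.indicator_apply]
    simp only [Set.mem_ofPred_eq]
    rw [h2, ← ENNReal.ofReal_natCast]
    exact ENNReal.ofReal_le_ofReal h1.le
  have hnq : 0 < n * q := mul_pos hn' hq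
  calc _ ≤ P {ω | ENNReal.ofReal (n * q) ≤ F ω} := measure_mono hsub
    _ ≤ (∫⁻ ω, F ω ∂P) / ENNReal.ofReal (n * q) :=
        meas_ge_le_lintegral_div hFm.aemeasurable (ENNReal.ofReal_pos.2 hnq).ne'
          ENNReal.ofReal_ne_top
    _ ≤ ENNReal.ofReal (n * p) / ENNReal.ofReal (n * q) := by gcongr
    _ = ENNReal.ofReal (p / q) := by
        rw [← ENNReal.ofReal_div_of_pos hnq, mul_div_mul_left _ _ hn'.ne']

variable [IsProbabilityMeasure P] {ι : Type*} {W : ι → Ω → ℝ} {c K : ℝ}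

/-- A non-integrable exponential has moment generating function 0 by default, so integrability
follows from positivity of the product. -/
lemma integrable_exp_mul_sum_of_iIndepFun (hm : ∀ i, AEMeasurable (W i) P)
    (hind : iIndepFun W P) (S : Finset ι) {s : ℝ}
    (hi : ∀ i, Integrable (fun ω => Real.exp (s * W i ω)) P) :
    Integrable (fun ω => Real.exp (s * (∑ i ∈ S, W i) ω)) P := by
  rw [← mgf_pos_iff, hind.mgf_sum₀ hm]
  exact Finset.prod_pos fun i _ => mgf_pos (hi i)

lemma measure_sum_ge_le (hc : 0 < c) (hW : ∀ i, HasExpMoment P (W i) c K)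
    (hmean : ∀ i, ∫ ω, W i ω ∂P = 0) (hind : iIndepFun W P) {s ε : ℝ} (hs : 0 ≤ s)
    (hsc : s ≤ c / 2) (hsε : 8 / c ^ 2 * K * s ≤ ε / 2) (S : Finset ι) :
    P {ω | ε * S.card ≤ ∑ i ∈ S, W i ω} ≤ ENNReal.ofReal (Real.exp (-(s * ε / 2) * S.card)) := by
  have hm : ∀ i, AEMeasurable (W i) P := fun i => (hW i).aemeasurable
  have habs : |s| ≤ c := by rw [abs_of_nonneg hs]; linarith
  have hi : Integrable (fun ω => Real.exp (s * (∑ i ∈ S, W i) ω)) P :=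
    integrable_exp_mul_sum_of_iIndepFun hm hind S fun i => (hW i).integrable_exp_mul habs
  have h1 := measure_ge_le_exp_mul_mgf (ε * S.card) hs hi
  rw [hind.mgf_sum₀ hm] at h1
  simp only [Finset.sum_apply] at h1
  rw [← ofReal_measureReal]
  refine ENNReal.ofReal_le_ofReal (h1.trans ?_)
  calc _ ≤ Real.exp (-s * (ε * S.card)) * ∏ i ∈ S, Real.exp (8 / c ^ 2 * K * s ^ 2) := by
        gcongr with i _
        · exact fun i _ => mgf_nonneg
        · exact (hW i).mgf_le_exp_sq hc (hmean i) (by rwa [abs_of_nonneg hs])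
    _ = Real.exp (-s * (ε * S.card) + S.card * (8 / c ^ 2 * K * s ^ 2)) := by
        rw [Finset.prod_const, ← Real.exp_nat_mul, ← Real.exp_add]
    _ ≤ _ := by
        rw [Real.exp_le_exp]
        have h2 : 8 / c ^ 2 * K * s * s ≤ ε / 2 * s := by gcongr
        have h3 := mul_le_mul_of_nonneg_left h2 (Nat.cast_nonneg (α := ℝ) S.card)
        nlinarith

/-- A Bernstein-type bound for sums of independent centred variables with an exponential
moment. -/
lemma measure_abs_sum_gt_le (hc : 0 < c) (hW : ∀ i, HasExpMoment P (W i) c K)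
    (hmean : ∀ i, ∫ ω, W i ω ∂P = 0) (hind : iIndepFun W P) {s ε : ℝ} (hs : 0 ≤ s)
    (hsc : s ≤ c / 2) (hsε : 8 / c ^ 2 * K * s ≤ ε / 2) (S : Finset ι) :
    P {ω | ε * S.card < |∑ i ∈ S, W i ω|} ≤
      ENNReal.ofReal (2 * Real.exp (-(s * ε / 2) * S.card)) := by
  have h1 := measure_sum_ge_le hc hW hmean hind hs hsc hsε S
  have hW' : ∀ i, HasExpMoment P (fun ω => -W i ω) c K := fun i =>
    ⟨(hW i).aemeasurable.neg, by simpa using (hW i).integrable, by simpa using (hW i).integral_le⟩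
  have hind' : iIndepFun (fun i ω => -W i ω) P :=
    hind.comp (fun _ y => -y) fun _ => measurable_neg
  have h2 := measure_sum_ge_le hc hW' (fun i => by rw [integral_neg, hmean, neg_zero]) hind' hs
    hsc hsε S
  have hsub : {ω | ε * S.card < |∑ i ∈ S, W i ω|} ⊆
      {ω | ε * S.card ≤ ∑ i ∈ S, W i ω} ∪ {ω | ε * S.card ≤ ∑ i ∈ S, -W i ω} := by
    intro ω hω
    rcases lt_abs.1 (show ε * S.card < |∑ i ∈ S, W i ω| from hω) with h | h
    · exact Or.inl h.le
    · right
      simp only [Set.mem_ofPred_eq, Finset.sum_neg_distrib]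
      exact h.le
  calc _ ≤ _ := measure_mono hsub
    _ ≤ _ := measure_union_le _ _
    _ ≤ _ := add_le_add h1 h2
    _ = _ := by
        rw [← ENNReal.ofReal_add (Real.exp_pos _).le (Real.exp_pos _).le, ← two_mul]

/-- The excesses of independent variables with an exponential moment above a high level have a
small sum. -/
lemma measure_sum_excess_gt_le [Fintype ι] (hc : 0 < c) (hW : ∀ i, HasExpMoment P (W i) c K)
    (hind : iIndepFun W P) (T s : ℝ) :
    P {ω | s < ∑ i, max (|W i ω| - T) 0} ≤
      ENNReal.ofReal (Real.exp (Fintype.card ι * (K * Real.exp (-c * T)) - c * s)) := by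
  have hm : ∀ i, AEMeasurable (W i) P := fun i => (hW i).aemeasurable
  set V : ι → Ω → ℝ := fun i ω => max (|W i ω| - T) 0 with hV
  have hVm : ∀ i, AEMeasurable (V i) P := fun i => by
    have := hm i
    fun_prop
  have hVind : iIndepFun V P :=
    hind.comp (fun _ y => max (|y| - T) 0) fun _ => by fun_prop
  have hle : ∀ i ω, Real.exp (c * V i ω) ≤ 1 + Real.exp (-c * T) * Real.exp (c * |W i ω|) := by
    intro i ω
    rw [← Real.exp_add]
    rcases le_total (|W i ω| - T) 0 with h | h
    · simp only [hV, max_eq_right h, mul_zero, Real.exp_zero]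
      linarith [Real.exp_pos (-c * T + c * |W i ω|)]
    · simp only [hV, max_eq_left h]
      have : c * (|W i ω| - T) = -c * T + c * |W i ω| := by ring
      rw [this]
      linarith
  have hbi : ∀ i, Integrable (fun ω => 1 + Real.exp (-c * T) * Real.exp (c * |W i ω|)) P :=
    fun i => (integrable_const _).add ((hW i).integrable.const_mul _)
  have hVi : ∀ i, Integrable (fun ω => Real.exp (c * V i ω)) P := fun i => by
    refine (hbi i).mono' ?_ (ae_of_all _ fun ω => ?_)
    · have := hVm i
      exact AEMeasurable.aestronglyMeasurable (by fun_prop)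
    · rw [Real.norm_of_nonneg (Real.exp_pos _).le]
      exact hle i ω
  have hmgf : ∀ i, mgf (V i) P c ≤ Real.exp (K * Real.exp (-c * T)) := by
    intro i
    have h1 : mgf (V i) P c ≤ ∫ ω, (1 + Real.exp (-c * T) * Real.exp (c * |W i ω|)) ∂P :=
      integral_mono (hVi i) (hbi i) (hle i)
    rw [integral_add (integrable_const _) ((hW i).integrable.const_mul _),
      integral_const_mul] at h1
    have h2 := mul_le_mul_of_nonneg_left (hW i).integral_le (Real.exp_pos (-c * T)).le
    simp only [integral_const, probReal_univ, smul_eq_mul, mul_one] at h1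
    linarith [Real.add_one_le_exp (K * Real.exp (-c * T))]
  have hi : Integrable (fun ω => Real.exp (c * (∑ i, V i) ω)) P :=
    integrable_exp_mul_sum_of_iIndepFun hVm hVind _ hVi
  have h1 := measure_ge_le_exp_mul_mgf s hc.le hi
  rw [hVind.mgf_sum₀ hVm] at h1
  simp only [Finset.sum_apply] at h1
  calc P {ω | s < ∑ i, max (|W i ω| - T) 0}
      ≤ P {ω | s ≤ ∑ i, V i ω} := measure_mono fun ω (hω : s < ∑ i, V i ω) => hω.le
    _ ≤ _ := by
      rw [← ofReal_measureReal]
      refine ENNReal.ofReal_le_ofReal (h1.trans ?_)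
      calc _ ≤ Real.exp (-c * s) * ∏ i : ι, Real.exp (K * Real.exp (-c * T)) := by
            gcongr with i _
            · exact fun i _ => mgf_nonneg
            · exact hmgf i
        _ = _ := by
            rw [Finset.prod_const, ← Real.exp_nat_mul, ← Real.exp_add, Finset.card_univ]
            congr 1
            ring

end Concentration

/-! ### The statistical model and its finite-sample error bound. -/

lemma HasExpMoment.comp_hasLaw {Ω S : Type*} [MeasurableSpace Ω] [MeasurableSpace S]
    {P : Measure Ω} {ν : Measure S} {Y : Ω → S} (hY : HasLaw Y ν P) {w : S → ℝ} {c K : ℝ}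
    (hw : Measurable w) (h : HasExpMoment ν w c K) :
    HasExpMoment P (fun ω => w (Y ω)) c K := by
  have hm : AEStronglyMeasurable (fun x => Real.exp (c * |w x|)) (P.map Y) :=
    Measurable.aestronglyMeasurable (by fun_prop)
  have h2 := h.integrable
  have h3 := h.integral_le
  rw [← hY.map_eq] at h2 h3
  rw [integral_map hY.aemeasurable hm] at h3
  exact ⟨hw.comp_aemeasurable hY.aemeasurable, (integrable_map_measure hm hY.aemeasurable).1 h2, h3⟩

/-- Independent data `X i`, drawn from the components `zs i` of a family of product exponential
distributions whose centred sufficient statistics have an exponential moment. -/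
structure IsClusterModel {n k d : ℕ} (E : Fin d → ExpFamily) (θ : Fin k → Fin d → ℝ)
    (zs : Fin n → Fin k) {Ω : Type*} [MeasurableSpace Ω] (P : Measure Ω)
    (X : Fin n → Ω → Fin d → ℝ) (c K : ℝ) : Prop where
  pos : 0 < c
  mem_natParam : ∀ a l, θ a l ∈ (E l).natParam
  indep : iIndepFun X P
  law : ∀ i, HasLaw (X i) (productLaw E (θ (zs i))) P
  isProb : ∀ a l, IsProbabilityMeasure ((E l).law (θ a l))
  expMoment : ∀ a l, HasExpMoment ((E l).law (θ a l)) ((E l).centred (θ a l)) c K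

section Model

variable {n k d : ℕ} {E : Fin d → ExpFamily} {θ : Fin k → Fin d → ℝ} {zs : Fin n → Fin k}
  {Ω : Type*} [MeasurableSpace Ω] {P : Measure Ω} {X : Fin n → Ω → Fin d → ℝ}

/-- Since no cluster is empty, each component is the law of some data point; normalization and tail
bounds pass from the sample to the component. -/
lemma isClusterModel_of_tail [IsProbabilityMeasure P] {C : ℝ} (hC : 0 < C)
    (hθ : ∀ a l, θ a l ∈ (E l).natParam)
    (hindep : iIndepFun X P) (hlaw : ∀ i, HasLaw (X i) (productLaw E (θ (zs i))) P)
    (hsub : ∀ (i : Fin n) (l : Fin d) (s : ℝ), 0 ≤ s →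
      P.real {ω | s ≤ |(E l).u (X i ω l) - (E l).mean (θ (zs i) l)|} ≤ 2 * Real.exp (-C * s))
    (hne : ∀ a, (cluster zs a).Nonempty) : IsClusterModel E θ zs P X (C / 2) 3 := by
  have hex : ∀ a, ∃ i, zs i = a := fun a => by
    obtain ⟨i, hi⟩ := hne a
    exact ⟨i, by simpa [cluster] using hi⟩
  have hprob : ∀ a l, IsProbabilityMeasure ((E l).law (θ a l)) := by
    intro a l
    obtain ⟨i, rfl⟩ := hex a
    exact isProbabilityMeasure_law_of_productLaw E (hθ _)
      ((hlaw i).isProbabilityMeasure_iff.1 inferInstance) l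
  refine ⟨by positivity, hθ, hindep, hlaw, hprob, fun a l => ?_⟩
  obtain ⟨i, rfl⟩ := hex a
  have := hprob (zs i) l
  refine hasExpMoment_of_tail hC ((E l).measurable_centred _).aemeasurable fun s hs => ?_
  have h1 := (map_eval_productLaw E (hθ (zs i)) (hprob (zs i)) l).fun_comp (hlaw i)
  have h2 := h1.measureReal_eq (p := fun y => s ≤ |(E l).centred (θ (zs i) l) y|)
    (measurableSet_le measurable_const (by fun_prop))
  rw [← h2]
  exact hsub i l s hs

lemma abs_mean_sub_le_maxGap (E : Fin d → ExpFamily) (θ : Fin k → Fin d → ℝ) {a b : Fin k}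
    (hab : a ≠ b) (l : Fin d) : |(E l).mean (θ a l) - (E l).mean (θ b l)| ≤ maxGap E θ := by
  calc _ ≤ ‖meanVec E (θ a) - meanVec E (θ b)‖ :=
        norm_le_pi_norm (meanVec E (θ a) - meanVec E (θ b)) l
    _ ≤ _ := le_ciSup (f := fun p : {p : Fin k × Fin k // p.1 ≠ p.2} =>
        ‖meanVec E (θ p.1.1) - meanVec E (θ p.1.2)‖) (Set.finite_range _).bddAbove ⟨(a, b), hab⟩

lemma maxGap_nonneg (E : Fin d → ExpFamily) (θ : Fin k → Fin d → ℝ) : 0 ≤ maxGap E θ :=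
  Real.iSup_nonneg fun _ => norm_nonneg _

lemma abs_mean_sub_le_maxGap' (E : Fin d → ExpFamily) (θ : Fin k → Fin d → ℝ) (a b : Fin k)
    (l : Fin d) : |(E l).mean (θ a l) - (E l).mean (θ b l)| ≤ maxGap E θ := by
  by_cases hab : a = b
  · simpa [hab] using maxGap_nonneg E θ
  · exact abs_mean_sub_le_maxGap E θ hab l

lemma chernoffFamily_le_chernoff (E : Fin d → ExpFamily) (θ : Fin k → Fin d → ℝ) {a b : Fin k}
    (hab : a ≠ b) : chernoffFamily E θ ≤
      chernoff (productRef E) (productPdf E (θ a)) (productPdf E (θ b)) :=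
  ciInf_le (f := fun p : {p : Fin k × Fin k // p.1 ≠ p.2} =>
    chernoff (productRef E) (productPdf E (θ p.1.1)) (productPdf E (θ p.1.2)))
    (Set.finite_range _).bddBelow ⟨(a, b), hab⟩

namespace IsClusterModel

variable {c K : ℝ}

lemma expMoment_sample (h : IsClusterModel E θ zs P X c K) (i : Fin n) (l : Fin d) :
    HasExpMoment P (fun ω => (E l).centred (θ (zs i) l) (X i ω l)) c K :=
  (h.expMoment (zs i) l).comp_hasLaw
    ((map_eval_productLaw E (h.mem_natParam (zs i)) (h.isProb (zs i)) l).fun_comp (h.law i))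
    ((E l).measurable_centred _)

lemma integral_sample (h : IsClusterModel E θ zs P X c K) (i : Fin n) (l : Fin d) :
    ∫ ω, (E l).centred (θ (zs i) l) (X i ω l) ∂P = 0 := by
  have h1 := (map_eval_productLaw E (h.mem_natParam (zs i)) (h.isProb (zs i)) l).fun_comp (h.law i)
  have := h.isProb (zs i) l
  rw [← (E l).integrable_centred_mean h.pos (h.expMoment (zs i) l)]
  conv_rhs => rw [← h1.map_eq]
  rw [integral_map h1.aemeasurable (Measurable.aestronglyMeasurable (by fun_prop))]

lemma indep_sample (h : IsClusterModel E θ zs P X c K) (l : Fin d) :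
    iIndepFun (fun i ω => (E l).centred (θ (zs i) l) (X i ω l)) P :=
  h.indep.comp (fun i x => (E l).centred (θ (zs i) l) (x l)) fun i => by fun_prop

lemma chernoffFamily_nonneg (h : IsClusterModel E θ zs P X c K) : 0 ≤ chernoffFamily E θ := by
  refine Real.iInf_nonneg fun p => ?_
  exact chernoff_nonneg (productPdf_nonneg E _) (productPdf_nonneg E _)
    (integrable_productPdf E (h.mem_natParam _)) (integrable_productPdf E (h.mem_natParam _))
    (integral_productPdf E (h.mem_natParam _) (h.isProb _))
    (integral_productPdf E (h.mem_natParam _) (h.isProb _))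

/-- Read backwards, this turns separation in Chernoff information into a lower bound on Δ. -/
lemma chernoffFamily_le (h : IsClusterModel E θ zs P X c K) (hk : 2 ≤ k) {m : ℝ} (hm : 0 < m)
    (hconv : ∀ l : Fin d,
      StrongConvexOn (convexHull ℝ (Set.range (fun a => θ a l))) m (E l).cumulant) :
    chernoffFamily E θ ≤ d * (2 / m * maxGap E θ ^ 2) := by
  obtain ⟨a, b, hab⟩ : ∃ a b : Fin k, a ≠ b :=
    ⟨⟨0, by omega⟩, ⟨1, by omega⟩, by simp⟩
  refine (chernoffFamily_le_chernoff E θ hab).trans ?_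
  refine chernoff_productPdf_le E (h.mem_natParam a) (h.mem_natParam b) (h.isProb a) (h.isProb b)
    h.pos hm (h.expMoment a) (h.expMoment b) (fun l => ?_) (abs_mean_sub_le_maxGap E θ hab)
  have := h.isProb a l
  have := h.isProb b l
  exact (E l).strongConvexOn_cumulant_gap (hconv l) h.pos
    (subset_convexHull ℝ _ ⟨a, rfl⟩) (subset_convexHull ℝ _ ⟨b, rfl⟩) (h.mem_natParam a l)
    (h.mem_natParam b l) (h.expMoment a l) (h.expMoment b l)

lemma measure_productPdf_le (h : IsClusterModel E θ zs P X c K) (hpos : 0 < chernoffFamily E θ)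
    {s : ℝ} (hs : 0 ≤ s) (i : Fin n) {b : Fin k} (hb : b ≠ zs i) :
    P {ω | productPdf E (θ (zs i)) (X i ω) ≤ Real.exp s * productPdf E (θ b) (X i ω)} ≤
      ENNReal.ofReal (Real.exp (s - chernoffFamily E θ)) := by
  have hch := chernoffFamily_le_chernoff E θ hb
  rw [(h.law i).measure_eq (p := fun x => productPdf E (θ (zs i)) x ≤
    Real.exp s * productPdf E (θ b) x) (measurableSet_le (by fun_prop) (by fun_prop))]
  refine (withDensity_le_exp_sub_chernoff (productPdf_nonneg E _) (productPdf_nonneg E _)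
    (by fun_prop) (by fun_prop) (integrable_productPdf E (h.mem_natParam _))
    (integrable_productPdf E (h.mem_natParam _)) (hpos.trans_le hch) hs).trans ?_
  exact ENNReal.ofReal_le_ofReal (Real.exp_le_exp.2 (by linarith))

/-- The event that the point `i` is at risk of being misclassified even when the cluster means
are estimated accurately. -/
def riskEvent (E : Fin d → ExpFamily) (θ : Fin k → Fin d → ℝ) (zs : Fin n → Fin k)
    (X : Fin n → Ω → Fin d → ℝ) (s v : ℝ) (i : Fin n) : Set Ω :=
  {ω | (∃ b, b ≠ zs i ∧
      productPdf E (θ (zs i)) (X i ω) ≤ Real.exp s * productPdf E (θ b) (X i ω)) ∨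
    v ≤ ∑ l, |(E l).centred (θ (zs i) l) (X i ω l)|}

lemma measure_riskEvent_le (h : IsClusterModel E θ zs P X c K) (hpos : 0 < chernoffFamily E θ)
    (hK : 0 ≤ K) {s : ℝ} (hs : 0 ≤ s) (v : ℝ) (i : Fin n) :
    P (riskEvent E θ zs X s v i) ≤ ENNReal.ofReal
      (k * Real.exp (s - chernoffFamily E θ) + K ^ d * Real.exp (-c * v)) := by
  have h1 : P {ω | ∃ b, b ≠ zs i ∧ productPdf E (θ (zs i)) (X i ω) ≤
      Real.exp s * productPdf E (θ b) (X i ω)} ≤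
      ENNReal.ofReal (k * Real.exp (s - chernoffFamily E θ)) := by
    have e : {ω | ∃ b, b ≠ zs i ∧ productPdf E (θ (zs i)) (X i ω) ≤
        Real.exp s * productPdf E (θ b) (X i ω)} = ⋃ b, {ω | b ≠ zs i ∧
        productPdf E (θ (zs i)) (X i ω) ≤ Real.exp s * productPdf E (θ b) (X i ω)} := by
      ext ω; simp
    rw [e]
    refine (measure_iUnion_fintype_le P _).trans ?_
    calc _ ≤ ∑ b : Fin k, ENNReal.ofReal (Real.exp (s - chernoffFamily E θ)) := by
          refine Finset.sum_le_sum fun b _ => ?_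
          by_cases hb : b = zs i
          · simp [hb]
          · refine (measure_mono fun ω hω => ?_).trans (h.measure_productPdf_le hpos hs i hb)
            exact hω.2
      _ = _ := by
          rw [Finset.sum_const, Finset.card_univ, Fintype.card_fin, nsmul_eq_mul,
            ENNReal.ofReal_mul (by positivity), ENNReal.ofReal_natCast]
  have h2 : P {ω | v ≤ ∑ l, |(E l).centred (θ (zs i) l) (X i ω l)|} ≤
      ENNReal.ofReal (K ^ d * Real.exp (-c * v)) := by
    rw [(h.law i).measure_eq (p := fun x => v ≤ ∑ l, |(E l).centred (θ (zs i) l) (x l)|)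
      (measurableSet_le measurable_const (by fun_prop))]
    exact productLaw_sum_abs_ge_le E (h.mem_natParam _) (h.isProb _) h.pos.le (h.expMoment _) v
  rw [ENNReal.ofReal_add (by positivity) (by positivity)]
  exact (measure_union_le _ _).trans (add_le_add h1 h2)

lemma measure_exists_abs_sum_gt_le [IsProbabilityMeasure P] (h : IsClusterModel E θ zs P X c K)
    {s ε v : ℝ} (hs : 0 ≤ s) (hsc : s ≤ c / 2) (hε : 0 ≤ ε) (hsε : 8 / c ^ 2 * K * s ≤ ε / 2)
    (hv : ∀ a, v ≤ ((cluster zs a).card : ℝ)) :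
    P {ω | ∃ a l, ε * (cluster zs a).card <
      |∑ i ∈ cluster zs a, (E l).centred (θ (zs i) l) (X i ω l)|} ≤
      ENNReal.ofReal (k * d * (2 * Real.exp (-(s * ε / 2) * v))) := by
  have e : {ω | ∃ a l, ε * (cluster zs a).card <
      |∑ i ∈ cluster zs a, (E l).centred (θ (zs i) l) (X i ω l)|} =
      ⋃ p : Fin k × Fin d, {ω | ε * (cluster zs p.1).card <
        |∑ i ∈ cluster zs p.1, (E p.2).centred (θ (zs i) p.2) (X i ω p.2)|} := by
    ext ω; simp
  rw [e]
  refine (measure_iUnion_fintype_le P _).trans ?_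
  calc _ ≤ ∑ p : Fin k × Fin d, ENNReal.ofReal (2 * Real.exp (-(s * ε / 2) * v)) := by
        refine Finset.sum_le_sum fun p _ => ?_
        refine (measure_abs_sum_gt_le h.pos (fun i => h.expMoment_sample i p.2)
          (fun i => h.integral_sample i p.2) (h.indep_sample p.2) hs hsc hsε _).trans ?_
        refine ENNReal.ofReal_le_ofReal ?_
        have h0 : 0 ≤ s * ε / 2 := by positivity
        have := mul_le_mul_of_nonneg_left (hv p.1) h0
        refine mul_le_mul_of_nonneg_left (Real.exp_le_exp.2 ?_) zero_le_two
        linarith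
    _ = _ := by
        rw [Finset.sum_const, Finset.card_univ, Fintype.card_prod, Fintype.card_fin,
          Fintype.card_fin, nsmul_eq_mul, ← ENNReal.ofReal_natCast,
          ← ENNReal.ofReal_mul (by positivity), Nat.cast_mul]

lemma measure_exists_sum_excess_gt_le [IsProbabilityMeasure P]
    (h : IsClusterModel E θ zs P X c K) (T v : ℝ) :
    P {ω | ∃ l, v < ∑ i, max (|(E l).centred (θ (zs i) l) (X i ω l)| - T) 0} ≤
      ENNReal.ofReal (d * Real.exp (n * (K * Real.exp (-c * T)) - c * v)) := by
  have e : {ω | ∃ l, v < ∑ i, max (|(E l).centred (θ (zs i) l) (X i ω l)| - T) 0} =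
      ⋃ l, {ω | v < ∑ i, max (|(E l).centred (θ (zs i) l) (X i ω l)| - T) 0} := by
    ext ω; simp
  rw [e]
  refine (measure_iUnion_fintype_le P _).trans ?_
  calc _ ≤ ∑ l : Fin d, ENNReal.ofReal (Real.exp (n * (K * Real.exp (-c * T)) - c * v)) := by
        refine Finset.sum_le_sum fun l _ => ?_
        have := measure_sum_excess_gt_le h.pos (fun i => h.expMoment_sample i l)
          (h.indep_sample l) T v
        rwa [Fintype.card_fin] at this
    _ = _ := by
        rw [Finset.sum_const, Finset.card_univ, Fintype.card_fin, nsmul_eq_mul,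
          ENNReal.ofReal_mul (by positivity), ENNReal.ofReal_natCast]

/-- A finite-sample bound for the probability that some iteration misclassifies more than a
fraction `q` of the points. -/
theorem measure_labelLoss_gt_le [IsProbabilityMeasure P] (h : IsClusterModel E θ zs P X c K)
    (hpos : 0 < chernoffFamily E θ) (hK : 0 ≤ K) {α N ε s T L₀ L r ρ S V q : ℝ}
    (hα : 0 < α) (hN : 0 < N) (hε : 0 ≤ ε) (hs : 0 ≤ s) (hsc : s ≤ c / 2)
    (hsε : 8 / c ^ 2 * K * s ≤ ε / 2)
    (hcard : ∀ a, α * N ≤ ((cluster zs a).card : ℝ))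
    (hL₀ : L₀ ≤ α * N / 2) (hL₀Δ : L₀ * maxGap E θ ≤ ε * N) (hT : 0 ≤ T) (hL₀T : L₀ * T ≤ ε * N)
    (hL : 0 ≤ L) (hερ : 2 * (ε + 3 * ε / α) ≤ ρ) (hρ : ρ ≤ r)
    (hbreg : ∀ a l y, |y - (E l).mean (θ a l)| ≤ r → ∀ x,
      |bregman (E l).dual x y - (E l).dual x - ((E l).cumulant (θ a l) - x * θ a l)| ≤
        L * |y - (E l).mean (θ a l)| * (|y - (E l).mean (θ a l)| + |x - (E l).mean (θ a l)|))
    (hS : 0 ≤ S) (hLS : L * ρ * (d * (2 * ρ + maxGap E θ) + 2 * V) ≤ S) (hq : 0 < q)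
    (hqL : n * q ≤ L₀) (zhat : ℕ → Ω → Fin n → Fin k)
    (hstep : ∀ t ω, IsBregmanStep E (fun i => X i ω) (zhat t ω) (zhat (t + 1) ω)) :
    P {ω | ¬ ∀ t : ℕ, 1 ≤ t → (labelLoss zs (zhat t ω) : ℝ) ≤ n * q} ≤
      P {ω | L₀ < (labelLoss zs (zhat 0 ω) : ℝ)} +
        ENNReal.ofReal (k * d * (2 * Real.exp (-(s * ε / 2) * (α * N)))) +
        ENNReal.ofReal (d * Real.exp (n * (K * Real.exp (-c * T)) - c * (ε * N))) +
        ENNReal.ofReal ((k * Real.exp (S - chernoffFamily E θ) + K ^ d * Real.exp (-c * V)) / q) := by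
  classical
  have hρ0 : 0 ≤ ρ := le_trans (by positivity) hερ
  have p1 := h.measure_exists_abs_sum_gt_le hs hsc hε hsε hcard
  have p2 := h.measure_exists_sum_excess_gt_le T (ε * N)
  have p3 := measure_card_gt_le (riskEvent E θ zs X S V) hq (h.measure_riskEvent_le hpos hK hS V)
  -- The four bad events are: poor initialization, a true-cluster sum off its mean, a large total
  -- excess, and too many points at risk. Outside them the statement is deterministic.
  refine le_trans (measure_mono fun ω hω => ?_) ((measure_union_le _ _).trans
    (add_le_add ((measure_union_le _ _).trans (add_le_add
      ((measure_union_le _ _).trans (add_le_add le_rfl p1)) p2)) p3))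
  by_contra hcon
  simp only [Set.mem_union, Set.mem_ofPred_eq, not_or, not_exists, not_lt, not_forall] at hcon
  obtain ⟨⟨⟨h0, h1⟩, h2⟩, B, hB, hBc⟩ := hcon
  refine hω fun t ht => le_trans ?_ hBc
  have hBL : (B.card : ℝ) ≤ L₀ := hBc.trans hqL
  have hL₀0 : 0 ≤ L₀ := le_trans (Nat.cast_nonneg _) hBL
  refine Nat.cast_le.2 (labelLoss_le_card_of_step E (x := fun i => X i ω) hBL ?_
    (fun t => hstep t ω) h0 t ht)
  intro z z' hzz' hz i hi
  refine hB i ?_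
  by_contra hr
  simp only [riskEvent, Set.mem_ofPred_eq, not_or, not_exists, not_and, not_le] at hr
  have hmean := abs_empMean_sub_le E θ (x := fun i => X i ω) (zs := zs) (z := z)
    (abs_mean_sub_le_maxGap' E θ) hα hN hε hcard (hz.trans hL₀)
    ((mul_le_mul_of_nonneg_right hz (maxGap_nonneg E θ)).trans hL₀Δ)
    ((mul_le_mul_of_nonneg_right hz hT).trans hL₀T) h1 h2
  refine absurd (productPdf_le_of_step E θ (zs := zs) hL hρ0 hρ (abs_mean_sub_le_maxGap' E θ) hbreg
    (fun a l => (hmean a l).trans hερ) hzz' i (s := S) ?_) (not_le.2 (hr.1 (z' i) hi))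
  refine le_trans ?_ hLS
  have := hr.2.le
  gcongr

end IsClusterModel

end Model

/-! ### Limits, and the choice of the truncation level. -/

section Asymptotic

/-- Take for ξ n almost the least δ > 0 with p n δ ≤ δ. Each fixed δ in (0, 1) eventually qualifies,
so ξ tends to 0, and p n (ξ n) ≤ ξ n by monotonicity. -/
lemma exists_tendsto_zero_diagonal {p : ℕ → ℝ → ENNReal}
    (hanti : ∀ᶠ n in atTop, ∀ δ δ' : ℝ, δ ≤ δ' → p n δ' ≤ p n δ)
    (hlim : ∀ δ : ℝ, 0 < δ → δ < 1 → Tendsto (fun n => p n δ) atTop (𝓝 0)) :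
    ∃ ξ : ℕ → ℝ, Tendsto ξ atTop (𝓝 0) ∧ Tendsto (fun n => p n (ξ n)) atTop (𝓝 0) := by
  set S : ℕ → Set ℝ := fun n => {δ | 0 < δ ∧ p n δ ≤ ENNReal.ofReal δ} with hS
  have hmem : ∀ δ : ℝ, 0 < δ → δ < 1 → ∀ᶠ n in atTop, δ ∈ S n := fun δ h0 h1 =>
    ((hlim δ h0 h1).eventually (Iic_mem_nhds (ENNReal.ofReal_pos.2 h0))).mono fun n hn => ⟨h0, hn⟩
  have hbdd : ∀ n, BddBelow (S n) := fun n => ⟨0, fun δ hδ => hδ.1.le⟩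
  have hnn : ∀ n, 0 ≤ sInf (S n) := fun n => Real.sInf_nonneg fun δ hδ => hδ.1.le
  have hs : Tendsto (fun n => sInf (S n)) atTop (𝓝 0) := by
    rw [Metric.tendsto_atTop']
    intro e he
    have h := hmem (min (e / 2) (1 / 2)) (by positivity)
      (lt_of_le_of_lt (min_le_right _ _) (by norm_num))
    obtain ⟨n₀, hn₀⟩ := eventually_atTop.1 h
    refine ⟨n₀, fun n hn => ?_⟩
    rw [Real.dist_eq, sub_zero, abs_of_nonneg (hnn n)]
    refine lt_of_le_of_lt ((csInf_le (hbdd n) (hn₀ n hn.le)).trans (min_le_left _ _)) (by linarith)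
  -- The infimum may fail to be attained; the extra 1/(n + 1) puts an element of S n below ξ n.
  have hξ : Tendsto (fun n : ℕ => sInf (S n) + 1 / ((n : ℝ) + 1)) atTop (𝓝 0) := by
    simpa using hs.add tendsto_one_div_add_atTop_nhds_zero_nat
  refine ⟨_, hξ, ?_⟩
  have hup : Tendsto (fun n : ℕ => ENNReal.ofReal (sInf (S n) + 1 / ((n : ℝ) + 1))) atTop
      (𝓝 0) := by
    simpa using ENNReal.tendsto_ofReal hξ
  refine tendsto_of_tendsto_of_tendsto_of_le_of_le' tendsto_const_nhds hup
    (Eventually.of_forall fun _ => zero_le) ?_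
  filter_upwards [hanti, hmem (1 / 2) (by norm_num) (by norm_num)] with n ha hn
  obtain ⟨δ, hδ, hlt⟩ := exists_lt_of_csInf_lt (s := S n) ⟨_, hn⟩
    (show sInf (S n) < sInf (S n) + 1 / ((n : ℝ) + 1) by
      have : 0 < 1 / ((n : ℝ) + 1) := by positivity
      linarith)
  exact (ha δ _ hlt.le).trans (hδ.2.trans (ENNReal.ofReal_le_ofReal hlt.le))

lemma tendsto_pow_mul_exp_neg_mul {u : ℕ → ℝ} (hu : Tendsto u atTop atTop) (j : ℕ) {b : ℝ}
    (hb : 0 < b) : Tendsto (fun n => u n ^ j * Real.exp (-(b * u n))) atTop (𝓝 0) := by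
  have h := ((isLittleO_pow_exp_pos_mul_atTop j hb).tendsto_div_nhds_zero).comp hu
  refine h.congr fun n => ?_
  simp only [Function.comp_apply]
  rw [Real.exp_neg, div_eq_mul_inv]

section Size

variable {k d : ℕ → ℕ}

lemma eventually_log_sq_le (hk : ∀ n, 2 ≤ k n)
    (hsize : (fun n => (k n : ℝ) * Real.log ((d n : ℝ) * (k n : ℝ)) ^ 2)
      =o[atTop] (fun n => (n : ℝ)))
    {B : ℝ} (hB : 0 < B) :
    ∀ᶠ n : ℕ in atTop, B * Real.log ((d n : ℝ) * (k n : ℝ)) ^ 2 ≤ (n : ℝ) / (k n : ℝ) := by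
  filter_upwards [hsize.bound (inv_pos.2 hB)] with n hn
  have hk0 : (0 : ℝ) < k n := by exact_mod_cast (by have := hk n; omega)
  rw [Real.norm_of_nonneg (by positivity), Real.norm_of_nonneg (by positivity)] at hn
  rw [le_div_iff₀ hk0]
  calc B * Real.log ((d n : ℝ) * (k n : ℝ)) ^ 2 * k n
      = B * (k n * Real.log ((d n : ℝ) * (k n : ℝ)) ^ 2) := by ring
    _ ≤ B * (B⁻¹ * n) := by gcongr
    _ = n := by field_simp

lemma log_two_le_log_mul (hk : ∀ n, 2 ≤ k n) (hd : ∀ n, 1 ≤ d n) (n : ℕ) : Real.log 2 ≤ Real.log ((d n : ℝ) * (k n : ℝ)) := by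
  have h1 : (2 : ℝ) ≤ k n := by exact_mod_cast hk n
  have h2 : (1 : ℝ) ≤ d n := by exact_mod_cast hd n
  exact Real.log_le_log (by norm_num) (by nlinarith)

lemma tendsto_div_atTop_of_size (hk : ∀ n, 2 ≤ k n) (hd : ∀ n, 1 ≤ d n)
    (hsize : (fun n => (k n : ℝ) * Real.log ((d n : ℝ) * (k n : ℝ)) ^ 2)
      =o[atTop] (fun n => (n : ℝ))) :
    Tendsto (fun n : ℕ => (n : ℝ) / (k n : ℝ)) atTop atTop := by
  have hl : 0 < Real.log 2 := Real.log_pos (by norm_num)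
  rw [tendsto_atTop]
  intro b
  filter_upwards [eventually_log_sq_le hk hsize
    (show 0 < (|b| + 1) / Real.log 2 ^ 2 by positivity)] with n hn
  have h1 := log_two_le_log_mul hk hd n
  have h2 : Real.log 2 ^ 2 ≤ Real.log ((d n : ℝ) * (k n : ℝ)) ^ 2 := by gcongr
  calc b ≤ |b| + 1 := by linarith [le_abs_self b]
    _ = (|b| + 1) / Real.log 2 ^ 2 * Real.log 2 ^ 2 := by field_simp
    _ ≤ (|b| + 1) / Real.log 2 ^ 2 * Real.log ((d n : ℝ) * (k n : ℝ)) ^ 2 := by gcongr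
    _ ≤ _ := hn

/-- Since log(dk) ≥ log 2, control of its square by n/k also controls log(dk) itself, and the
prefactor kd is absorbed by half the exponent. -/
lemma tendsto_mul_exp_neg_size (hk : ∀ n, 2 ≤ k n) (hd : ∀ n, 1 ≤ d n)
    (hsize : (fun n => (k n : ℝ) * Real.log ((d n : ℝ) * (k n : ℝ)) ^ 2)
      =o[atTop] (fun n => (n : ℝ)))
    {g : ℝ} (hg : 0 < g) :
    Tendsto (fun n : ℕ => (k n : ℝ) * d n * Real.exp (-(g * ((n : ℝ) / (k n : ℝ))))) atTop
      (𝓝 0) := by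
  have hl : 0 < Real.log 2 := Real.log_pos (by norm_num)
  have hlim := tendsto_pow_mul_exp_neg_mul (tendsto_div_atTop_of_size hk hd hsize) 0 (half_pos hg)
  refine tendsto_of_tendsto_of_tendsto_of_le_of_le' tendsto_const_nhds hlim
    (Eventually.of_forall fun n => by positivity) ?_
  filter_upwards [eventually_log_sq_le hk hsize
    (show 0 < 2 / (g * Real.log 2) by positivity)] with n hn
  have h1 := log_two_le_log_mul hk hd n
  set N := (n : ℝ) / (k n : ℝ)
  have hk0 : (0 : ℝ) < k n := by exact_mod_cast (by have := hk n; omega)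
  have hd0 : (0 : ℝ) < d n := by exact_mod_cast hd n
  have h2 : Real.log ((d n : ℝ) * (k n : ℝ)) ≤ g / 2 * N := by
    set y := Real.log ((d n : ℝ) * (k n : ℝ))
    calc y = y * Real.log 2 / Real.log 2 := by field_simp
      _ ≤ y * y / Real.log 2 := by gcongr; linarith
      _ = g / 2 * (2 / (g * Real.log 2) * y ^ 2) := by field_simp
      _ ≤ _ := by gcongr
  calc (k n : ℝ) * d n * Real.exp (-(g * N))
      = Real.exp (Real.log ((d n : ℝ) * (k n : ℝ)) + -(g * N)) := by
        rw [Real.exp_add, Real.exp_log (by positivity), mul_comm (k n : ℝ)]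
    _ ≤ Real.exp (-(g / 2 * N)) := by
        rw [Real.exp_le_exp]; linarith
    _ = _ := by simp

end Size

/-- The exponential dominates the fourth power of its argument over 24, which recovers x from its
fourth root; 144 = 3 · 24 · 2. Applied with x = k, it bounds the expected excess. -/
lemma three_mul_exp_neg_le {c ε A x : ℝ} (hc : 0 < c) (hε : 0 < ε) (h1 : 1 ≤ c * A)
    (hA : 144 / (c * ε) ≤ c * A) (hx : 1 ≤ x) :
    3 * Real.exp (-c * (A * √√x)) ≤ c * ε / 2 / x := by
  have hx0 : 0 < x := by linarith
  have hr : √√x ^ 4 = x := by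
    rw [show (4 : ℕ) = 2 * 2 from rfl, pow_mul, Real.sq_sqrt (Real.sqrt_nonneg _),
      Real.sq_sqrt hx0.le]
  have h2 := Real.pow_div_factorial_le_exp (c * A * √√x) (by positivity) 4
  rw [mul_pow, hr, show ((Nat.factorial 4 : ℕ) : ℝ) = 24 by norm_num [Nat.factorial]] at h2
  have h3 : c * A ≤ (c * A) ^ 4 := le_self_pow₀ h1 (by norm_num)
  have h4 : 144 ≤ (c * A) ^ 4 * (c * ε) := by
    rw [div_le_iff₀ (by positivity)] at hA
    exact hA.trans (by gcongr)
  rw [show -c * (A * √√x) = -(c * A * √√x) by ring, Real.exp_neg, ← div_eq_mul_inv,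
    div_le_div_iff₀ (Real.exp_pos _) hx0]
  calc 3 * x = 144 * x / 48 := by ring
    _ ≤ (c * A) ^ 4 * (c * ε) * x / 48 := by gcongr
    _ = c * ε / 2 * ((c * A) ^ 4 * x / 24) := by ring
    _ ≤ _ := by gcongr

/-- The two bounds on the Chernoff information give A²√k ≤ Δ²: the truncation level A k^(1/4) does
not exceed Δ. -/
lemma mul_sqrt_sqrt_le {m A d k Ch Δ : ℝ} (hm : 0 < m) (hd : 0 < d)
    (hΔ : 0 ≤ Δ) (hle : Ch ≤ d * (2 / m * Δ ^ 2)) (hge : 2 * A ^ 2 / m * (d * √k) ≤ Ch) :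
    A * √√k ≤ Δ := by
  refine le_of_sq_le_sq ?_ hΔ
  rw [mul_pow, Real.sq_sqrt (Real.sqrt_nonneg _)]
  have h := hge.trans hle
  have e1 : 2 * A ^ 2 / m * (d * √k) = 2 * d / m * (A ^ 2 * √k) := by ring
  have e2 : d * (2 / m * Δ ^ 2) = 2 * d / m * Δ ^ 2 := by ring
  rw [e1, e2] at h
  exact le_of_mul_le_mul_left h (by positivity)

end Asymptotic

/-! ### Assembly of the asymptotic theorem. -/

lemma eventually_isClusterModel {k d : ℕ → ℕ} (hk : ∀ n, 2 ≤ k n)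
    {E : ∀ n, Fin (d n) → ExpFamily} {θ : ∀ n, Fin (k n) → Fin (d n) → ℝ}
    (hθ : ∀ n a l, θ n a l ∈ (E n l).natParam) {zstar : ∀ n, Fin n → Fin (k n)}
    {Ω : ℕ → Type*} [∀ n, MeasurableSpace (Ω n)]
    {P : ∀ n, Measure (Ω n)} [∀ n, IsProbabilityMeasure (P n)]
    {X : ∀ n, Fin n → Ω n → (Fin (d n) → ℝ)}
    (hindep : ∀ n, iIndepFun (X n) (P n))
    (hlaw : ∀ n i, HasLaw (X n i) (productLaw (E n) (θ n (zstar n i))) (P n))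
    {C α : ℝ} (hC : 0 < C) (hα : 0 < α)
    (hsub : ∀ᶠ n in atTop, ∀ (i : Fin n) (l : Fin (d n)) (s : ℝ), 0 ≤ s →
      (P n).real {ω | s ≤ |(E n l).u (X n i ω l) - (E n l).mean (θ n (zstar n i) l)|}
        ≤ 2 * Real.exp (-C * s))
    (hbal : ∀ᶠ n in atTop, ∀ a : Fin (k n),
      α * (n : ℝ) / (k n : ℝ) ≤ ((cluster (zstar n) a).card : ℝ)) :
    ∀ᶠ n in atTop, IsClusterModel (E n) (θ n) (zstar n) (P n) (X n) (C / 2) 3 := by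
  filter_upwards [hsub, hbal, eventually_gt_atTop 0] with n h1 h2 hn
  refine isClusterModel_of_tail hC (hθ n) (hindep n) (hlaw n) h1 fun a => ?_
  have hk0 : (0 : ℝ) < k n := by exact_mod_cast (by have := hk n; omega)
  have hn0 : (0 : ℝ) < n := by exact_mod_cast hn
  have h3 : (0 : ℝ) < (cluster (zstar n) a).card := lt_of_lt_of_le (by positivity) (h2 a)
  exact Finset.card_pos.1 (by exact_mod_cast h3)

-- For fixed δ all auxiliary constants can be fixed independently of n, and each of the four terms
-- of `measure_labelLoss_gt_le` tends to 0.
set_option maxHeartbeats 2000000 in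
lemma tendsto_measure_labelLoss_gt {k d : ℕ → ℕ} (hk : ∀ n, 2 ≤ k n) (hd : ∀ n, 1 ≤ d n)
    {E : ∀ n, Fin (d n) → ExpFamily} {θ : ∀ n, Fin (k n) → Fin (d n) → ℝ}
    {zstar : ∀ n, Fin n → Fin (k n)}
    {Ω : ℕ → Type*} [∀ n, MeasurableSpace (Ω n)]
    {P : ∀ n, Measure (Ω n)} [∀ n, IsProbabilityMeasure (P n)]
    {X : ∀ n, Fin n → Ω n → (Fin (d n) → ℝ)} {c : ℝ} (hc : 0 < c)
    (hmodel : ∀ᶠ n in atTop, IsClusterModel (E n) (θ n) (zstar n) (P n) (X n) c 3)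
    (hsize : (fun n => (k n : ℝ) * Real.log ((d n : ℝ) * (k n : ℝ)) ^ 2)
      =o[atTop] (fun n => (n : ℝ)))
    {α : ℝ} (hα : 0 < α) (hbal : ∀ᶠ n in atTop, ∀ a : Fin (k n),
      α * (n : ℝ) / (k n : ℝ) ≤ ((cluster (zstar n) a).card : ℝ))
    {m M : ℝ} (hm : 0 < m) (hcurv : ∀ᶠ n in atTop, ∀ (a : Fin (k n)) (l : Fin (d n)),
      iteratedDeriv 2 (E n l).dual ((E n l).mean (θ n a l)) ∈ Set.Icc m M)
    {m' : ℝ} (hm' : 0 < m') (hconv : ∀ᶠ n in atTop, ∀ l : Fin (d n),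
      StrongConvexOn (convexHull ℝ (Set.range (fun a => θ n a l))) m' (E n l).cumulant)
    (hgap : (fun n => maxGap (E n) (θ n))
      =O[atTop] (fun n => ((d n : ℝ))⁻¹ * chernoffFamily (E n) (θ n)))
    (hsep : ∀ B : ℝ, 0 < B → ∀ᶠ n in atTop, B * (d n * √(k n : ℝ)) ≤ chernoffFamily (E n) (θ n))
    {zhat : ∀ n, ℕ → Ω n → Fin n → Fin (k n)}
    (hstep : ∀ n t ω, IsBregmanStep (E n) (fun i => X n i ω) (zhat n t ω) (zhat n (t + 1) ω))
    (hinit : ∀ ε : ℝ, 0 < ε → Tendsto (fun n => P n {ω |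
        ε * ((n : ℝ) / ((k n : ℝ) * maxGap (E n) (θ n)))
          < (labelLoss (zstar n) (zhat n 0 ω) : ℝ)}) atTop (𝓝 0))
    {δ : ℝ} (hδ : 0 < δ) (hδ1 : δ < 1) :
    Tendsto (fun n => P n {ω | ¬ ∀ t : ℕ, 1 ≤ t → (labelLoss (zstar n) (zhat n t ω) : ℝ) ≤
      n * Real.exp (-(1 - δ) * chernoffFamily (E n) (θ n))}) atTop (𝓝 0) := by
  obtain ⟨D, hD, hgapD⟩ := hgap.exists_pos
  obtain ⟨r, L, hr, hL, hbreg⟩ := ExpFamily.exists_bregman_dual_bound (M := M) hc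
    (by norm_num : (1 : ℝ) ≤ 3) hm
  -- With V = R · Ch the deviation term is at most 3^d e^(-4 Ch) ≤ e^(-2 Ch), still negligible after
  -- division by q.
  set R : ℝ := 4 / c with hR
  have hR0 : 0 < R := by positivity
  -- Makes the total cost error at most δ/2 · Ch, leaving another δ/2 for Markov's inequality and
  -- the factor k.
  set ρ : ℝ := min r (min 1 (δ / (2 * L * (2 + D + 2 * R)))) with hρ
  have hρ0 : 0 < ρ := by positivity
  have hρr : ρ ≤ r := min_le_left _ _
  have hρ1 : ρ ≤ 1 := (min_le_right _ _).trans (min_le_left _ _)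
  have hρδ : L * ρ * (2 + D + 2 * R) ≤ δ / 2 := by
    have h := (min_le_right r _).trans (min_le_right (1 : ℝ) (δ / (2 * L * (2 + D + 2 * R))))
    rw [← hρ, le_div_iff₀ (by positivity)] at h
    linarith
  set ε : ℝ := ρ / (2 * (1 + 3 / α)) with hε
  have hε0 : 0 < ε := by positivity
  have hερ : 2 * (ε + 3 * ε / α) = ρ := by
    rw [hε]; field_simp
  set s : ℝ := min (c / 2) (ε / (2 * (8 / c ^ 2 * 3))) with hs
  have hs0 : 0 < s := by positivity
  have hsc : s ≤ c / 2 := min_le_left _ _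
  have hsε : 8 / c ^ 2 * 3 * s ≤ ε / 2 := by
    have h := min_le_right (c / 2) (ε / (2 * (8 / c ^ 2 * 3)))
    rw [← hs, le_div_iff₀ (by positivity)] at h
    linarith
  -- The first two summands are for `three_mul_exp_neg_le`; the third gives Δ ≥ 2ε/α, so that L₀ is
  -- at most half the smallest cluster size bound.
  set A : ℝ := 1 / c + 144 / (c * ε) / c + 2 * ε / α with hA
  have hA0 : 0 < A := by positivity
  have hcA : c * A = 1 + 144 / (c * ε) + c * (2 * ε / α) := by
    rw [hA]; field_simp
  have hcA1 : 1 ≤ c * A := by rw [hcA, add_assoc]; linarith [show 0 ≤ 144 / (c * ε) + c * (2 * ε / α) by positivity]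
  have hcA2 : 144 / (c * ε) ≤ c * A := by
    rw [hcA]; linarith [show 0 ≤ c * (2 * ε / α) by positivity]
  have hAα : 2 * ε / α ≤ A := by
    rw [hA]; linarith [show 0 ≤ 1 / c + 144 / (c * ε) / c by positivity]
  set Ch : ℕ → ℝ := fun n => chernoffFamily (E n) (θ n) with hCh
  set Δ : ℕ → ℝ := fun n => maxGap (E n) (θ n) with hΔ
  have hk1 : ∀ n, (1 : ℝ) ≤ k n := fun n => by exact_mod_cast (by have := hk n; omega)
  have hd1 : ∀ n, (1 : ℝ) ≤ d n := fun n => by exact_mod_cast hd n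
  have hsk : ∀ n, 1 ≤ √(k n : ℝ) := fun n => Real.one_le_sqrt.2 (hk1 n)
  have hChtop : Tendsto Ch atTop atTop := by
    rw [tendsto_atTop]
    intro b
    filter_upwards [hsep (|b| + 1) (by positivity)] with n hn
    refine le_trans ?_ hn
    have : (1 : ℝ) ≤ d n * √(k n : ℝ) := one_le_mul_of_one_le_of_one_le (hd1 n) (hsk n)
    nlinarith [le_abs_self b, abs_nonneg b]
  -- With k ≤ Ch² and Δ ≤ D · Ch this yields q k Δ ≤ ε, that is nq ≤ L₀: the error set after one
  -- step meets the initialization requirement.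
  have hsmall : ∀ᶠ n in atTop, D * (Ch n ^ 3 * Real.exp (-((1 - δ) * Ch n))) < ε := by
    have h := (tendsto_pow_mul_exp_neg_mul hChtop 3 (by linarith : 0 < 1 - δ)).const_mul D
    rw [mul_zero] at h
    exact h.eventually (gt_mem_nhds hε0)
  have t1 := hinit ε hε0
  have t2 := ENNReal.tendsto_ofReal ((tendsto_mul_exp_neg_size hk hd hsize
    (show 0 < s * ε / 2 * α by positivity)).const_mul 2)
  have t3 := ENNReal.tendsto_ofReal (tendsto_mul_exp_neg_size hk hd hsize
    (show 0 < c * ε / 2 by positivity))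
  have t4 := ENNReal.tendsto_ofReal ((tendsto_pow_mul_exp_neg_mul hChtop 2 (half_pos hδ)).add
    (tendsto_pow_mul_exp_neg_mul hChtop 0 (half_pos hδ)))
  have hsum := ((t1.add t2).add t3).add t4
  simp only [mul_zero, add_zero, ENNReal.ofReal_zero] at hsum
  refine tendsto_of_tendsto_of_tendsto_of_le_of_le' tendsto_const_nhds hsum
    (Eventually.of_forall fun _ => zero_le) ?_
  filter_upwards [hmodel, hbal, hcurv, hconv, hgapD.bound, hsep 1 one_pos,
    hsep (2 * A ^ 2 / m') (by positivity), hsmall, eventually_gt_atTop 0]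
    with n hmod hbaln hcurvn hconvn hgapn hsep1 hsep2 hsmalln hn
  have hn0 : (0 : ℝ) < n := by exact_mod_cast hn
  have hk0 : (0 : ℝ) < k n := by linarith [hk1 n]
  have hd0 : (0 : ℝ) < d n := by linarith [hd1 n]
  have hdk : (d n : ℝ) * √(k n : ℝ) ≤ Ch n := by simpa using hsep1
  have hdCh : (d n : ℝ) ≤ Ch n := le_trans (le_mul_of_one_le_right hd0.le (hsk n)) hdk
  have hkCh : (k n : ℝ) ≤ Ch n ^ 2 := by
    have h := le_trans (le_mul_of_one_le_left (Real.sqrt_nonneg _) (hd1 n)) hdk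
    calc (k n : ℝ) = √(k n : ℝ) ^ 2 := (Real.sq_sqrt hk0.le).symm
      _ ≤ _ := by gcongr
  have hChpos : 0 < Ch n := lt_of_lt_of_le hd0 hdCh
  have hΔ0 : 0 ≤ Δ n := maxGap_nonneg _ _
  have hdΔ : d n * Δ n ≤ D * Ch n := by
    rw [Real.norm_of_nonneg hΔ0, Real.norm_of_nonneg (by positivity)] at hgapn
    calc d n * Δ n ≤ d n * (D * ((d n : ℝ)⁻¹ * Ch n)) := by gcongr
      _ = _ := by field_simp
  have hΔCh : Δ n ≤ D * Ch n := (le_mul_of_one_le_left hΔ0 (hd1 n)).trans hdΔ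
  set N : ℝ := (n : ℝ) / (k n : ℝ) with hN
  have hN0 : 0 < N := by positivity
  set T : ℝ := A * √√(k n : ℝ) with hT
  have hTΔ : T ≤ Δ n := mul_sqrt_sqrt_le hm' hd0 hΔ0 (hmod.chernoffFamily_le (hk n) hm' hconvn) hsep2
  have hAT : A ≤ T := le_mul_of_one_le_right hA0.le (Real.one_le_sqrt.2 (hsk n))
  have hΔpos : 0 < Δ n := by linarith
  set L₀ : ℝ := ε * ((n : ℝ) / ((k n : ℝ) * Δ n)) with hL₀
  have hL₀e : L₀ = ε * N / Δ n := by rw [hL₀, hN]; field_simp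
  have hL₀nn : 0 ≤ L₀ := by positivity
  have hLΔ : L₀ * Δ n = ε * N := by rw [hL₀e]; field_simp
  set q : ℝ := Real.exp (-(1 - δ) * Ch n) with hq
  have hq0 : 0 < q := Real.exp_pos _
  have b := hmod.measure_labelLoss_gt_le hChpos (by norm_num : (0 : ℝ) ≤ 3) hα hN0 hε0.le hs0.le hsc
    hsε (fun a => by rw [hN, ← mul_div_assoc]; exact hbaln a) (L₀ := L₀) (T := T) (L := L) (r := r)
    (ρ := ρ) (S := δ / 2 * Ch n) (V := R * Ch n) (q := q)
    (by
      rw [hL₀e, div_le_iff₀ hΔpos]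
      have h2 : 2 * ε / α ≤ Δ n := by linarith
      rw [div_le_iff₀ hα] at h2
      nlinarith)
    hLΔ.le (by positivity) ((mul_le_mul_of_nonneg_left hTΔ hL₀nn).trans hLΔ.le) hL.le hερ.le hρr
    (fun a l => hbreg (E n l) (θ n a l) (hmod.isProb a l) (hmod.expMoment a l) (hcurvn a l))
    (by positivity)
    (by
      have h3 : (d n : ℝ) * (2 * ρ + Δ n) + 2 * (R * Ch n) ≤ (2 + D + 2 * R) * Ch n := by
        have : (d n : ℝ) * (2 * ρ) ≤ Ch n * 2 := by
          have : 2 * ρ ≤ 2 := by linarith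
          gcongr
        linarith
      calc L * ρ * ((d n : ℝ) * (2 * ρ + Δ n) + 2 * (R * Ch n))
          ≤ L * ρ * ((2 + D + 2 * R) * Ch n) := by gcongr
        _ = L * ρ * (2 + D + 2 * R) * Ch n := by ring
        _ ≤ _ := by gcongr)
    hq0
    (by
      have h3 : q = Real.exp (-((1 - δ) * Ch n)) := by rw [hq, neg_mul]
      rw [hL₀, ← mul_div_assoc, le_div_iff₀ (by positivity)]
      have h4 : q * (k n * Δ n) ≤ ε := by
        calc q * (k n * Δ n) ≤ q * (Ch n ^ 2 * (D * Ch n)) := by gcongr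
          _ = D * (Ch n ^ 3 * Real.exp (-((1 - δ) * Ch n))) := by rw [← h3]; ring
          _ ≤ ε := hsmalln.le
      nlinarith)
    (zhat n) (hstep n)
  refine b.trans (add_le_add (add_le_add (add_le_add le_rfl ?_) ?_) ?_)
  · refine ENNReal.ofReal_le_ofReal (le_of_eq ?_)
    rw [show -(s * ε / 2) * (α * N) = -(s * ε / 2 * α * N) by ring]
    ring
  · refine ENNReal.ofReal_le_ofReal ?_
    have h3 := three_mul_exp_neg_le hc hε0 hcA1 hcA2 (hk1 n)
    have h4 : (n : ℝ) * (3 * Real.exp (-c * T)) ≤ c * ε / 2 * N := by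
      calc _ ≤ (n : ℝ) * (c * ε / 2 / k n) := by gcongr
        _ = _ := by rw [hN]; ring
    calc _ ≤ (d n : ℝ) * Real.exp (-(c * ε / 2 * N)) := by
          refine mul_le_mul_of_nonneg_left (Real.exp_le_exp.2 ?_) hd0.le
          linarith
      _ ≤ _ := by
          refine mul_le_mul_of_nonneg_right ?_ (Real.exp_pos _).le
          exact le_mul_of_one_le_left hd0.le (hk1 n)
  · refine ENNReal.ofReal_le_ofReal ?_
    rw [div_le_iff₀ hq0, add_mul]
    have h5 : (3 : ℝ) ^ d n ≤ Real.exp (2 * Ch n) := by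
      calc (3 : ℝ) ^ d n ≤ Real.exp 2 ^ d n := by
            gcongr
            linarith [Real.add_one_le_exp (2 : ℝ)]
        _ = Real.exp (d n * 2) := by rw [← Real.exp_nat_mul]
        _ ≤ _ := Real.exp_le_exp.2 (by linarith)
    refine add_le_add ?_ ?_
    · rw [mul_assoc, hq, ← Real.exp_add]
      change (k n : ℝ) * Real.exp (δ / 2 * Ch n - Ch n) ≤ _
      calc _ ≤ Ch n ^ 2 * Real.exp (δ / 2 * Ch n - Ch n) := by gcongr
        _ = _ := by congr 2; ring
    · rw [pow_zero, one_mul, hq, ← Real.exp_add]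
      calc _ ≤ Real.exp (2 * Ch n) * Real.exp (-c * (R * Ch n)) := by gcongr
        _ ≤ _ := by
          rw [← Real.exp_add, Real.exp_le_exp, hR]
          have : -c * (4 / c * Ch n) = -4 * Ch n := by field_simp
          rw [this]
          nlinarith

theorem theorem3
    -- number of clusters, dimension, exponential families, parameters, true labels
    (k d : ℕ → ℕ) (hk : ∀ n, 2 ≤ k n) (hd : ∀ n, 1 ≤ d n)
    (E : ∀ n, Fin (d n) → ExpFamily)
    (θ : ∀ n, Fin (k n) → Fin (d n) → ℝ)
    (hθ : ∀ n a l, θ n a l ∈ (E n l).natParam)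
    (zstar : ∀ n, Fin n → Fin (k n))
    -- the data: independent points, the i-th one drawn from the component of its cluster
    {Ω : ℕ → Type*} [∀ n, MeasurableSpace (Ω n)]
    (P : ∀ n, Measure (Ω n)) [∀ n, IsProbabilityMeasure (P n)]
    (X : ∀ n, Fin n → Ω n → (Fin (d n) → ℝ))
    (hindep : ∀ n, iIndepFun (X n) (P n))
    (hlaw : ∀ n i, HasLaw (X n i)
      ((productRef (E n)).withDensity
        (fun x => ENNReal.ofReal (productPdf (E n) (θ n (zstar n i)) x))) (P n))
    -- sub-exponential sufficient statistics
    (hsub : ∃ C : ℝ, 0 < C ∧ ∀ᶠ n in atTop, ∀ (i : Fin n) (l : Fin (d n)) (s : ℝ), 0 ≤ s →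
      (P n).real {ω | s ≤ |(E n l).u (X n i ω l) - (E n l).mean (θ n (zstar n i) l)|}
        ≤ 2 * Real.exp (-C * s))
    -- dimension and cluster sizes
    (hsize : (fun n => (k n : ℝ) * Real.log ((d n : ℝ) * (k n : ℝ)) ^ 2)
      =o[atTop] (fun n => (n : ℝ)))
    (hbal : ∃ α : ℝ, 0 < α ∧ ∀ᶠ n in atTop, ∀ a : Fin (k n),
      α * (n : ℝ) / (k n : ℝ) ≤ ((cluster (zstar n) a).card : ℝ))
    -- curvature at the means, and strong convexity on the range of the parameters
    (hcurv : ∃ m M : ℝ, 0 < m ∧ ∀ᶠ n in atTop, ∀ (a : Fin (k n)) (l : Fin (d n)),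
      iteratedDeriv 2 (E n l).dual ((E n l).mean (θ n a l)) ∈ Set.Icc m M)
    (hconv : ∃ m : ℝ, 0 < m ∧ ∀ᶠ n in atTop, ∀ l : Fin (d n),
      StrongConvexOn (convexHull ℝ (Set.range (fun a => θ n a l))) m (E n l).cumulant)
    -- separation
    (hgap : (fun n => maxGap (E n) (θ n))
      =O[atTop] (fun n => ((d n : ℝ))⁻¹ * chernoffFamily (E n) (θ n)))
    (hsep : (fun n => (d n : ℝ) * √(k n : ℝ) *
        (1 + maxGap (E n) (θ n) / √((n : ℝ) / (k n : ℝ))))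
      =o[atTop] (fun n => chernoffFamily (E n) (θ n)))
    -- the labels produced by the iterations, from an arbitrary data-dependent initialisation
    (zhat : ∀ n, ℕ → Ω n → Fin n → Fin (k n))
    (hstep : ∀ n t ω, IsBregmanStep (E n) (fun i => X n i ω) (zhat n t ω) (zhat n (t + 1) ω))
    (hinit : ∀ ε : ℝ, 0 < ε → Tendsto (fun n => P n {ω |
        ε * ((n : ℝ) / ((k n : ℝ) * maxGap (E n) (θ n)))
          < (labelLoss (zstar n) (zhat n 0 ω) : ℝ)}) atTop (𝓝 0)) :
    ∀ c : ℝ, 0 < c → ∃ η : ℕ → ℝ, Tendsto η atTop (𝓝 0) ∧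
      Tendsto (fun n => P n {ω | ¬ ∀ t : ℕ, ⌊c * Real.log (n : ℝ)⌋₊ ≤ t →
        (labelLoss (zstar n) (zhat n t ω) : ℝ) / (n : ℝ)
          ≤ Real.exp (-(1 + η n) * chernoffFamily (E n) (θ n))}) atTop (𝓝 0) := by

  intro c hc
  obtain ⟨C, hC, hsub⟩ := hsub
  obtain ⟨α, hα, hbal⟩ := hbal
  obtain ⟨m, M, hm, hcurv⟩ := hcurv
  obtain ⟨m', hm', hconv⟩ := hconv
  have hmodel := eventually_isClusterModel hk hθ hindep hlaw hC hα hsub hbal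
  have hsep' : ∀ B : ℝ, 0 < B →
      ∀ᶠ n in atTop, B * (d n * √(k n : ℝ)) ≤ chernoffFamily (E n) (θ n) := by
    intro B hB
    filter_upwards [hsep.bound (inv_pos.2 hB), hmodel] with n hn hmod
    have h1 : 0 ≤ maxGap (E n) (θ n) / √((n : ℝ) / (k n : ℝ)) :=
      div_nonneg (maxGap_nonneg _ _) (Real.sqrt_nonneg _)
    rw [Real.norm_of_nonneg (by positivity), Real.norm_of_nonneg hmod.chernoffFamily_nonneg] at hn
    calc B * (d n * √(k n : ℝ)) ≤ B * (d n * √(k n : ℝ) *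
          (1 + maxGap (E n) (θ n) / √((n : ℝ) / (k n : ℝ)))) := by
          refine mul_le_mul_of_nonneg_left ?_ hB.le
          exact le_mul_of_one_le_right (by positivity) (by linarith)
      _ ≤ B * (B⁻¹ * chernoffFamily (E n) (θ n)) := by gcongr
      _ = _ := by field_simp
  -- The failure probability decreases in δ because the Chernoff information is eventually
  -- nonnegative.
  obtain ⟨ξ, hξ, hp⟩ := exists_tendsto_zero_diagonal (p := fun n δ => P n {ω | ¬ ∀ t : ℕ, 1 ≤ t →
    (labelLoss (zstar n) (zhat n t ω) : ℝ) ≤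
      n * Real.exp (-(1 - δ) * chernoffFamily (E n) (θ n))})
    (by
      filter_upwards [hmodel] with n hmod δ δ' hle
      refine measure_mono fun ω hω hall => hω fun t ht => (hall t ht).trans ?_
      have := hmod.chernoffFamily_nonneg
      gcongr)
    (fun δ hδ hδ1 => tendsto_measure_labelLoss_gt hk hd (by positivity) hmodel hsize hα hbal hm
      hcurv hm' hconv hgap hsep' hstep hinit hδ hδ1)
  refine ⟨fun n => -ξ n, by simpa using hξ.neg, ?_⟩
  refine tendsto_of_tendsto_of_tendsto_of_le_of_le' tendsto_const_nhds hp
    (Eventually.of_forall fun _ => zero_le) ?_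
  -- One iteration is enough, so the logarithmic time only has to reach 1.
  have hlog : ∀ᶠ n : ℕ in atTop, 1 ≤ c * Real.log (n : ℝ) :=
    ((Real.tendsto_log_atTop.comp tendsto_natCast_atTop_atTop).const_mul_atTop hc).eventually_ge_atTop 1
  filter_upwards [hlog, eventually_gt_atTop 0] with n hn hn0
  refine measure_mono fun ω hω hall => hω fun t ht => ?_
  have h1 : 1 ≤ ⌊c * Real.log (n : ℝ)⌋₊ := Nat.le_floor (by simpa using hn)
  have h2 := hall t (h1.trans ht)
  rw [div_le_iff₀ (by exact_mod_cast hn0), mul_comm]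
  exact h2
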